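/- Let $d\ge 1$ be a fixed integer and let $\alpha>0$ be a fixed real number. For a partition $\lambda=(\lambda_1\ge\lambda_2\ge\cdots)$, identified with its Young diagram $\{(i,j): i\ge 1,\ 1\le j\le\lambda_i\}$, let $\lambda'$ be the conjugate partition, let $\ell(\lambda)$ be the number of nonzero parts, and put $$c_\lambda(\alpha)=\prod_{(i,j)\in\lambda}\bigl(\alpha(\lambda_i-j)+(\lambda'_j-i)+1\bigr),\qquad c'_\lambda(\alpha)=\prod_{(i,j)\in\lambda}\bigl(\alpha(\lambda_i-j)+(\lambda'_j-i)+\alpha\bigr).$$ For $\beta>0$ let $$Z'_d(\beta)=\int e^{-\frac{d\beta}{2}(x_1^2+\cdots+x_d^2)}\prod_{1\le i<j\le d}(x_i-x_j)^\beta\,dx_1\cdots dx_{d-1},$$ where the integral runs over all $(x_1,\dots,x_{d-1})\in\mathbb{R}^{d-1}$ such that $x_1\ge\cdots\ge x_{d-1}\ge x_d$ with $x_d:=-(x_1+\cdots+x_{d-1})$ (so $Z'_1(\beta)=1$). Then, as $n\to\infty$, $$\sum_{\lambda\vdash n,\ \ell(\lambda)\le d}\frac{n!}{c_\lambda(\alpha)}\,\frac{n!}{c'_\lambda(\alpha)}\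 \sim\ \frac{\Gamma(1/\alpha)^d\,d^{\,2n+d^2/\alpha}}{(2\pi)^{d-1}\,\alpha^{\,2n+\frac{d^2-d}{2\alpha}+\frac{d-1}{2}}\,n^{\frac{d^2+d}{2\alpha}-\frac{d+1}{2}}}\;Z'_d(2/\alpha),$$ where $\sim$ means that the ratio of the two sides tends to $1$. -/

import Mathlib

open scoped BigOperators

/-- Only finitely many Young diagrams have `n` cells. -/
theorem finite_youngDiagram_card_length (n d : ℕ) :
    {μ : YoungDiagram | μ.card = n ∧ μ.colLen 0 ≤ d}.Finite := by
  have hinj : Set.InjOn YoungDiagram.cells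
      {μ : YoungDiagram | μ.card = n ∧ μ.colLen 0 ≤ d} := fun μ _ ν _ h => YoungDiagram.ext h
  refine Set.Finite.of_finite_image (Set.Finite.subset
    (Finset.finite_toSet ((Finset.range n ×ˢ Finset.range n).powerset)) ?_) hinj
  rintro _ ⟨μ, ⟨hμ, -⟩, rfl⟩
  simp only [Finset.coe_powerset, Set.mem_preimage, Set.mem_powerset_iff, Finset.coe_subset]
  rintro ⟨i, j⟩ hij
  have hij' : (i, j) ∈ μ := hij
  have h1 : μ.rowLen i ≤ n := by
    rw [← hμ, YoungDiagram.rowLen_eq_card]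
    exact Finset.card_le_card (Finset.filter_subset _ _)
  have h2 : μ.colLen j ≤ n := by
    rw [← hμ, YoungDiagram.colLen_eq_card]
    exact Finset.card_le_card (Finset.filter_subset _ _)
  have h3 := YoungDiagram.mem_iff_lt_rowLen.1 hij'
  have h4 := YoungDiagram.mem_iff_lt_colLen.1 hij'
  simp only [Finset.mem_product, Finset.mem_range]
  omega

/-- The partitions of `n` of length at most `d`, as Young diagrams. The length (number of
nonzero parts) is the length of the first column. -/
noncomputable def partitionsOfLengthLE (n d : ℕ) : Finset YoungDiagram :=
  (finite_youngDiagram_card_length n d).toFinset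

theorem mem_partitionsOfLengthLE {n d : ℕ} {μ : YoungDiagram} :
    μ ∈ partitionsOfLengthLE n d ↔ μ.card = n ∧ μ.colLen 0 ≤ d := by
  simp [partitionsOfLengthLE]

/-- The arm length `λ_i - j` of a cell. Cells are indexed from `(0, 0)`, so the cell `(i, j)`
in one-based indexing is `s = (i - 1, j - 1)`. -/
def armLength (μ : YoungDiagram) (s : ℕ × ℕ) : ℝ :=
  (μ.rowLen s.1 : ℝ) - ((s.2 : ℝ) + 1)

/-- The leg length `λ'_j - i` of a cell. -/
def legLength (μ : YoungDiagram) (s : ℕ × ℕ) : ℝ :=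
  (μ.colLen s.2 : ℝ) - ((s.1 : ℝ) + 1)

/-- `c_λ(α) = ∏ (α (λ_i - j) + (λ'_j - i) + 1)` over the cells `(i, j)` of `λ`. -/
noncomputable def jackHookLower (α : ℝ) (μ : YoungDiagram) : ℝ :=
  ∏ s ∈ μ.cells, (α * armLength μ s + legLength μ s + 1)

/-- `c'_λ(α) = ∏ (α (λ_i - j) + (λ'_j - i) + α)` over the cells `(i, j)` of `λ`. -/
noncomputable def jackHookUpper (α : ℝ) (μ : YoungDiagram) : ℝ :=
  ∏ s ∈ μ.cells, (α * armLength μ s + legLength μ s + α)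

/-- The set of weakly decreasing vectors in `ℝ^d` with coordinate sum zero. -/
def tracelessChamber (d : ℕ) : Set (Fin d → ℝ) :=
  {x | (∀ i j : Fin d, i ≤ j → x j ≤ x i) ∧ ∑ i, x i = 0}

/-- Completes `(x_1, …, x_{d-1})` by the last coordinate `x_d = -(x_1 + ⋯ + x_{d-1})`. -/
noncomputable def tracelessExtend (d : ℕ) (y : Fin (d - 1) → ℝ) : Fin d → ℝ :=
  fun i => if h : (i : ℕ) < d - 1 then y ⟨i, h⟩ else -∑ k, y k

/-- `Z'_d(β)`: the integral over the chamber of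
`exp (-(d β / 2) ∑ x_i ^ 2) ∏_{i < j} (x_i - x_j) ^ β` with respect to `dx_1 ⋯ dx_{d-1}`. -/
noncomputable def regevIntegral (d : ℕ) (β : ℝ) : ℝ :=
  ∫ y : Fin (d - 1) → ℝ in {y | tracelessExtend d y ∈ tracelessChamber d},
    Real.exp (-((d : ℝ) * β / 2) * ∑ i, (tracelessExtend d y i) ^ 2) *
      ∏ i : Fin d, ∏ j ∈ Finset.Ioi i, (tracelessExtend d y i - tracelessExtend d y j) ^ β

/-!
Write `θ = 1 / α`. Up to the power `α ^ n`, each of `c_λ(α)`, `c'_λ(α)` is a product over the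
cells of `arm + θ * leg + s` with `s = θ` or `s = 1`, and telescoping along each row turns it
into a quotient of Gamma values of the row lengths and of their differences. At rows of length
about `n / d`, with fluctuations `x_i` on the scale `√(θ n)`, Stirling's formula makes every row
contribute a Gaussian density and every pair `i < j` a factor `(x_i - x_j) ^ θ` to each of the
two inverse hook products, so their product tends to the integrand of `Z'_d(2 / α)`. Every
inverse hook product also has a majorant that decays in `x` faster than any power, uniformly in
`n`; by dominated convergence the sum over the lattice of row lengths, read as a Riemann sum,
converges to `Z'_d(2 / α)`. The powers that were split off, together with Stirling's formula for
`n! ^ 2`, make up the prefactor.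
-/

open Filter MeasureTheory Topology

section Gamma

open Real

theorem prod_range_add_eq_Gamma_div {a : ℝ} (ha : 0 < a) (n : ℕ) :
    ∏ j ∈ Finset.range n, (a + j) = Gamma (n + a) / Gamma a := by
  induction n with
  | zero => simp [(Gamma_pos_of_pos ha).ne']
  | succ n ih =>
    rw [Finset.prod_range_succ, ih, Nat.cast_add_one, add_right_comm,
      Gamma_add_one (by positivity : (n : ℝ) + a ≠ 0)]
    ring

theorem GammaSeq_div_Gamma {a : ℝ} (ha : 0 < a) (n : ℕ) :
    GammaSeq a n / Gamma a = (n : ℝ) ^ a * n.factorial / Gamma (n + 1 + a) := by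
  rw [GammaSeq, prod_range_add_eq_Gamma_div ha, Nat.cast_add_one]
  have := (Gamma_pos_of_pos ha).ne'
  field_simp

theorem tendsto_Gamma_div_Gamma_mul_rpow {a b : ℝ} (ha : 0 < a) (hb : 0 < b) :
    Tendsto (fun k : ℕ => Gamma (k + a) / Gamma (k + b) * ((k : ℝ) + 1) ^ (b - a))
      atTop (𝓝 1) := by
  have normalized {c : ℝ} (hc : 0 < c) :
      Tendsto (fun n => GammaSeq c n / Gamma c) atTop (𝓝 1) := by
    simpa only [div_self (Gamma_pos_of_pos hc).ne'] using
      (GammaSeq_tendsto_Gamma c).div_const (Gamma c)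
  have shift : Tendsto (fun n : ℕ => ((n : ℝ) / (n + 2)) ^ (a - b)) atTop (𝓝 1) := by
    simpa only [one_rpow] using
      (tendsto_natCast_div_add_atTop (2 : ℝ)).rpow_const (p := a - b) (Or.inl one_ne_zero)
  rw [← tendsto_add_atTop_iff_nat 1]
  have quotient := ((normalized hb).div (normalized ha) one_ne_zero).mul shift
  rw [div_one, mul_one] at quotient
  refine quotient.congr' ?_
  filter_upwards [eventually_gt_atTop 0] with n hn
  have hn : (0 : ℝ) < n := Nat.cast_pos.2 hn
  have hΓa : Gamma (n + 1 + a) ≠ 0 := (Gamma_pos_of_pos (by positivity)).ne'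
  simp only [Pi.div_apply]
  rw [GammaSeq_div_Gamma ha, GammaSeq_div_Gamma hb, div_rpow hn.le (by positivity),
    rpow_sub hn, ← neg_sub a b, rpow_neg (by positivity), Nat.cast_add_one, add_assoc (n : ℝ) 1 1,
    one_add_one_eq_two]
  field_simp

theorem exists_Gamma_div_Gamma_le {a b : ℝ} (ha : 0 < a) (hb : 0 < b) :
    ∃ C, 0 ≤ C ∧ ∀ k : ℕ, Gamma (k + a) / Gamma (k + b) ≤ C * ((k : ℝ) + 1) ^ (a - b) := by
  obtain ⟨C, hC⟩ := (tendsto_Gamma_div_Gamma_mul_rpow ha hb).bddAbove_range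
  have bound (k : ℕ) : Gamma (k + a) / Gamma (k + b) ≤ C * ((k : ℝ) + 1) ^ (a - b) := by
    rw [← neg_sub b a, rpow_neg (by positivity), ← div_eq_mul_inv, le_div_iff₀ (by positivity)]
    exact hC ⟨k, rfl⟩
  exact ⟨C, (by positivity : (0 : ℝ) ≤ _).trans (hC ⟨0, rfl⟩), bound⟩

end Gamma

section LocalLimit

variable {ι : Type*} {l : Filter ι}

theorem tendsto_atTop_of_tendsto_div {k : ι → ℕ} {r : ι → ℝ} {x : ℝ} (hx : 0 < x)
    (hr : Tendsto r l atTop) (hk : Tendsto (fun n => (k n : ℝ) / r n) l (𝓝 x)) :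
    Tendsto k l atTop := by
  refine tendsto_natCast_atTop_iff.1 ((hk.pos_mul_atTop hx hr).congr' ?_)
  filter_upwards [hr.eventually_gt_atTop 0] with n hn
  exact div_mul_cancel₀ _ hn.ne'

theorem tendsto_div_one_of_sub_div_sqrt {u m : ι → ℝ} {x : ℝ} (hm : Tendsto m l atTop)
    (hx : Tendsto (fun n => (u n - m n) / √(m n)) l (𝓝 x)) :
    Tendsto (fun n => u n / m n) l (𝓝 1) := by
  have hlim := (hx.mul (tendsto_inv_atTop_zero.comp (Real.tendsto_sqrt_atTop.comp hm))).const_add 1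
  rw [mul_zero, add_zero] at hlim
  refine hlim.congr' ?_
  filter_upwards [hm.eventually_gt_atTop 0] with n hn
  simp only [Function.comp_apply]
  rw [← div_eq_mul_inv, div_div, Real.mul_self_sqrt hn.le, sub_div, div_self hn.ne']
  ring

theorem abs_mul_log_sub_le {δ : ℝ} (hδ : |δ| ≤ 1 / 2) :
    |(1 + δ) * Real.log (1 + δ) - δ - δ ^ 2 / 2| ≤ 4 * |δ| ^ 3 := by
  have hlog := Real.abs_log_sub_add_sum_range_le (x := -δ) (by rw [abs_neg]; linarith) 2
  simp only [Finset.sum_range_succ, Finset.sum_range_zero, sub_neg_eq_add, abs_neg] at hlog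
  have hδ0 : 0 ≤ |δ| ^ 3 := by positivity
  have hdiv : |δ| ^ (2 + 1) / (1 - |δ|) ≤ 2 * |δ| ^ 3 := by
    rw [div_le_iff₀ (by linarith), mul_right_comm]
    exact le_mul_of_one_le_left hδ0 (by linarith)
  have hlog' : |Real.log (1 + δ) - δ + δ ^ 2 / 2| ≤ 2 * |δ| ^ 3 := by
    refine le_trans (le_of_eq ?_) (hlog.trans hdiv)
    congr 1
    push_cast
    ring
  have hone : |1 + δ| ≤ 3 / 2 := by
    rw [abs_le] at hδ ⊢
    constructor <;> linarith
  calc |(1 + δ) * Real.log (1 + δ) - δ - δ ^ 2 / 2|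
      = |(1 + δ) * (Real.log (1 + δ) - δ + δ ^ 2 / 2) - δ ^ 3 / 2| := by ring_nf
    _ ≤ |(1 + δ) * (Real.log (1 + δ) - δ + δ ^ 2 / 2)| + |δ ^ 3 / 2| := abs_sub _ _
    _ = |1 + δ| * |Real.log (1 + δ) - δ + δ ^ 2 / 2| + |δ| ^ 3 / 2 := by
      rw [abs_mul, abs_div, abs_pow, abs_two]
    _ ≤ 3 / 2 * (2 * |δ| ^ 3) + |δ| ^ 3 / 2 := by gcongr
    _ ≤ 4 * |δ| ^ 3 := by linarith

theorem tendsto_mul_log_div_sub_add {u m : ι → ℝ} {x : ℝ} (hm : Tendsto m l atTop)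
    (hx : Tendsto (fun n => (u n - m n) / √(m n)) l (𝓝 x)) :
    Tendsto (fun n => u n * Real.log (u n / m n) - u n + m n) l (𝓝 (x ^ 2 / 2)) := by
  have hδ : Tendsto (fun n => u n / m n - 1) l (𝓝 0) := by
    simpa only [sub_self] using (tendsto_div_one_of_sub_div_sqrt hm hx).sub_const 1
  have hsq : ∀ᶠ n in l, ((u n - m n) / √(m n)) ^ 2 = m n * (u n / m n - 1) ^ 2 := by
    filter_upwards [hm.eventually_gt_atTop 0] with n hn
    rw [div_pow, Real.sq_sqrt hn.le]
    field_simp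
  have hentropy : ∀ᶠ n in l, u n * Real.log (u n / m n) - u n + m n =
      m n * ((1 + (u n / m n - 1)) * Real.log (1 + (u n / m n - 1)) - (u n / m n - 1)) := by
    filter_upwards [hm.eventually_gt_atTop 0] with n hn
    rw [add_sub_cancel]
    field_simp
    ring
  have hbound : Tendsto (fun n => 4 * |u n / m n - 1| * ((u n - m n) / √(m n)) ^ 2) l (𝓝 0) := by
    simpa only [abs_zero, mul_zero, zero_mul] using (hδ.abs.const_mul 4).mul (hx.pow 2)
  have herror : Tendsto (fun n => u n * Real.log (u n / m n) - u n + m n -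
      ((u n - m n) / √(m n)) ^ 2 / 2) l (𝓝 0) := by
    refine squeeze_zero_norm' ?_ hbound
    filter_upwards [hsq, hentropy, hm.eventually_gt_atTop 0,
      (abs_zero (α := ℝ) ▸ hδ.abs).eventually_le_const (by norm_num : (0 : ℝ) < 1 / 2)]
      with n hsq hentropy hn hsmall
    rw [hsq, hentropy, mul_div_assoc, ← mul_sub, Real.norm_eq_abs, abs_mul, abs_of_pos hn]
    calc _ ≤ m n * (4 * |u n / m n - 1| ^ 3) := by gcongr; exact abs_mul_log_sub_le hsmall
      _ = 4 * |u n / m n - 1| * (m n * |u n / m n - 1| ^ 2) := by ring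
      _ = _ := by rw [sq_abs]
  simpa only [sub_add_cancel, zero_add] using herror.add ((hx.pow 2).div_const 2)

theorem exp_neg_mul_pow_eq {m : ℝ} (hm : 0 < m) {k : ℕ} (hk : 0 < k) :
    Real.exp (-m) * m ^ k =
      (k / Real.exp 1) ^ k * Real.exp (-(k * Real.log (k / m) - k + m)) := by
  have hk' : (0 : ℝ) < k := Nat.cast_pos.2 hk
  rw [Real.log_div hk'.ne' hm.ne', ← Real.rpow_natCast, ← Real.rpow_natCast,
    Real.rpow_def_of_pos hm, Real.rpow_def_of_pos (by positivity),
    Real.log_div hk'.ne' (Real.exp_pos 1).ne', Real.log_exp, ← Real.exp_add, ← Real.exp_add]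
  congr 1
  ring

theorem tendsto_sqrt_mul_poisson {m : ι → ℝ} {k : ι → ℕ} {x : ℝ} (hm : Tendsto m l atTop)
    (hx : Tendsto (fun n => ((k n : ℝ) - m n) / √(m n)) l (𝓝 x)) :
    Tendsto (fun n => √(m n) * (Real.exp (-m n) * m n ^ k n / (k n).factorial)) l
      (𝓝 (Real.exp (-(x ^ 2 / 2)) / √(2 * Real.pi))) := by
  have hratio := tendsto_div_one_of_sub_div_sqrt hm hx
  have hk := tendsto_atTop_of_tendsto_div one_pos hm hratio
  have hstirling := Stirling.tendsto_stirlingSeq_sqrt_pi.comp hk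
  have hprod := (Real.continuous_exp.tendsto _).comp (tendsto_mul_log_div_sub_add hm hx).neg |>.div
    ((hratio.const_mul 2).sqrt.mul hstirling) (by positivity)
  rw [mul_one, ← Real.sqrt_mul zero_le_two] at hprod
  refine hprod.congr' ?_
  filter_upwards [hm.eventually_gt_atTop 0, hk.eventually_gt_atTop 0] with n hn hkn
  have hkn' : (0 : ℝ) < k n := Nat.cast_pos.2 hkn
  simp only [Function.comp_apply, Pi.div_apply]
  rw [exp_neg_mul_pow_eq hn hkn, Stirling.stirlingSeq, Real.sqrt_mul zero_le_two,
    Real.sqrt_mul zero_le_two, Real.sqrt_div hkn'.le]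
  have : 0 < √(m n) := Real.sqrt_pos.2 hn
  have : 0 < √(k n : ℝ) := Real.sqrt_pos.2 hkn'
  field_simp

/-- The Poisson mass of mean `m`, continued to the real argument `k + a - 1` and scaled by the
standard deviation `√m`. -/
noncomputable def gammaWeight (a m : ℝ) (k : ℕ) : ℝ :=
  Real.exp (-m) * m ^ (k + a - 1 / 2) / Real.Gamma (k + a)

theorem gammaWeight_nonneg {a m : ℝ} (ha : 0 < a) (hm : 0 ≤ m) (k : ℕ) :
    0 ≤ gammaWeight a m k := by
  unfold gammaWeight
  positivity

theorem gammaWeight_eq_mul_poisson {a m : ℝ} (ha : 0 < a) (hm : 0 < m) (k : ℕ) :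
    gammaWeight a m k =
      Real.Gamma (k + 1) / Real.Gamma (k + a) * ((k : ℝ) + 1) ^ (a - 1) *
        (m / (k + 1)) ^ (a - 1) * (√m * (Real.exp (-m) * m ^ k / k.factorial)) := by
  have hexponent : (k : ℝ) + a - 1 / 2 = k + (a - 1) + 1 / 2 := by ring
  rw [gammaWeight, Real.Gamma_nat_eq_factorial, Real.div_rpow hm.le (by positivity), hexponent,
    Real.rpow_add hm, Real.rpow_add hm, Real.rpow_natCast, ← Real.sqrt_eq_rpow]
  have : 0 < Real.Gamma (k + a) := by positivity
  field_simp

theorem tendsto_gammaWeight {a x : ℝ} (ha : 0 < a) {m : ι → ℝ} {k : ι → ℕ}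
    (hm : Tendsto m l atTop) (hx : Tendsto (fun n => ((k n : ℝ) - m n) / √(m n)) l (𝓝 x)) :
    Tendsto (fun n => gammaWeight a (m n) (k n)) l
      (𝓝 (Real.exp (-(x ^ 2 / 2)) / √(2 * Real.pi))) := by
  have hratio := tendsto_div_one_of_sub_div_sqrt hm hx
  have hk := tendsto_atTop_of_tendsto_div one_pos hm hratio
  have hshift : Tendsto (fun n => (m n / (k n + 1)) ^ (a - 1)) l (𝓝 1) := by
    have hinv := (hratio.add (tendsto_inv_atTop_zero.comp hm)).inv₀ (by norm_num)
    rw [add_zero, inv_one] at hinv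
    have := hinv.rpow_const (p := a - 1) (Or.inl one_ne_zero)
    rw [Real.one_rpow] at this
    refine this.congr fun n => ?_
    rw [Function.comp_apply, inv_eq_one_div (m n), ← add_div, inv_div]
  have hprod := (((tendsto_Gamma_div_Gamma_mul_rpow one_pos ha).comp hk).mul hshift).mul
    (tendsto_sqrt_mul_poisson hm hx)
  rw [one_mul, one_mul] at hprod
  refine hprod.congr' ?_
  filter_upwards [hm.eventually_gt_atTop 0] with n hn
  exact (gammaWeight_eq_mul_poisson ha hn (k n)).symm

theorem tendsto_Gamma_div_Gamma_div_rpow {a b x : ℝ} (ha : 0 < a) (hb : 0 < b) (hx : 0 < x)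
    {r : ι → ℝ} {k : ι → ℕ} (hr : Tendsto r l atTop)
    (hk : Tendsto (fun n => (k n : ℝ) / r n) l (𝓝 x)) :
    Tendsto (fun n => Real.Gamma (k n + a) / Real.Gamma (k n + b) / r n ^ (a - b)) l
      (𝓝 (x ^ (a - b))) := by
  have hktop := tendsto_atTop_of_tendsto_div hx hr hk
  have hshift : Tendsto (fun n => (((k n : ℝ) + 1) / r n) ^ (a - b)) l (𝓝 (x ^ (a - b))) := by
    have := hk.add (tendsto_inv_atTop_zero.comp hr)
    rw [add_zero] at this
    refine (this.rpow_const (p := a - b) (Or.inl hx.ne')).congr fun n => ?_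
    rw [Function.comp_apply, inv_eq_one_div, add_div]
  have hprod := ((tendsto_Gamma_div_Gamma_mul_rpow ha hb).comp hktop).mul hshift
  rw [one_mul] at hprod
  refine hprod.congr' ?_
  filter_upwards [hr.eventually_gt_atTop 0] with n hn
  rw [Function.comp_apply, Real.div_rpow (by positivity) hn.le, ← neg_sub a b,
    Real.rpow_neg (by positivity)]
  field_simp

end LocalLimit

section UniformBounds

theorem exp_neg_mul_pow_le {m : ℝ} (hm : 0 < m) (k : ℕ) :
    Real.exp (-m) * m ^ k ≤ (k / Real.exp 1) ^ k * Real.exp (-(√k - √m) ^ 2) := by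
  rcases k.eq_zero_or_pos with rfl | hk
  · simp [Real.sq_sqrt hm.le]
  have hk' : (0 : ℝ) < k := Nat.cast_pos.2 hk
  have hlog : Real.log (k / m) = 2 * Real.log (√k / √m) := by
    rw [← Real.sqrt_div hk'.le, Real.log_sqrt (by positivity)]
    ring
  have hentropy : 2 * (k - √k * √m) ≤ k * Real.log (k / m) := by
    calc 2 * ((k : ℝ) - √k * √m) = 2 * (√k ^ 2 * (1 - (√k / √m)⁻¹)) := by
          field_simp
          rw [mul_sub, Real.mul_self_sqrt hk'.le]
      _ ≤ 2 * (√k ^ 2 * Real.log (√k / √m)) := by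
          gcongr
          exact Real.one_sub_inv_le_log_of_pos (by positivity)
      _ = k * Real.log (k / m) := by
          rw [hlog, Real.sq_sqrt hk'.le]
          ring
  rw [exp_neg_mul_pow_eq hm hk]
  gcongr
  linarith [sub_sq (√(k : ℝ)) √m, Real.sq_sqrt hk'.le, Real.sq_sqrt hm.le]

theorem sqrt_succ_mul_pow_le_factorial (k : ℕ) :
    √((k : ℝ) + 1) * (k / Real.exp 1) ^ k ≤ k.factorial := by
  rcases k.eq_zero_or_pos with rfl | hk
  · simp
  have hk' : (1 : ℝ) ≤ k := by exact_mod_cast hk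
  refine le_trans ?_ (Stirling.le_factorial_stirling k)
  gcongr
  nlinarith [Real.pi_gt_three]

theorem poisson_le {m : ℝ} (hm : 0 < m) (k : ℕ) :
    Real.exp (-m) * m ^ k / k.factorial ≤ Real.exp (-(√k - √m) ^ 2) / √((k : ℝ) + 1) := by
  rw [div_le_div_iff₀ (by positivity) (by positivity)]
  calc Real.exp (-m) * m ^ k * √((k : ℝ) + 1)
      ≤ (k / Real.exp 1) ^ k * Real.exp (-(√k - √m) ^ 2) * √((k : ℝ) + 1) :=
        mul_le_mul_of_nonneg_right (exp_neg_mul_pow_le hm k) (Real.sqrt_nonneg _)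
    _ = Real.exp (-(√k - √m) ^ 2) * (√((k : ℝ) + 1) * (k / Real.exp 1) ^ k) := by ring
    _ ≤ Real.exp (-(√k - √m) ^ 2) * k.factorial := by
        gcongr
        exact sqrt_succ_mul_pow_le_factorial k

theorem exists_gammaWeight_le_rpow_mul_exp {a : ℝ} (ha : 0 < a) :
    ∃ C, 0 ≤ C ∧ ∀ m : ℝ, 0 < m → ∀ k : ℕ,
      gammaWeight a m k ≤ C * (m / (k + 1)) ^ (a - 1 / 2) * Real.exp (-(√k - √m) ^ 2) := by
  obtain ⟨C, hC, hbound⟩ := exists_Gamma_div_Gamma_le one_pos ha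
  refine ⟨C, hC, fun m hm k => ?_⟩
  have hratio : Real.Gamma (k + 1) / Real.Gamma (k + a) * ((k : ℝ) + 1) ^ (a - 1) ≤ C := by
    rw [← le_div_iff₀ (by positivity), div_eq_mul_inv C, ← Real.rpow_neg (by positivity), neg_sub]
    exact hbound k
  calc gammaWeight a m k
      ≤ C * (m / (k + 1)) ^ (a - 1) * (√m * (Real.exp (-(√k - √m) ^ 2) / √((k : ℝ) + 1))) := by
        rw [gammaWeight_eq_mul_poisson ha hm]
        gcongr ?_ * _ * (_ * ?_)
        exact poisson_le hm k
    _ = C * ((m / (k + 1)) ^ (a - 1) * (m / (k + 1)) ^ (1 / 2 : ℝ)) *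
          Real.exp (-(√k - √m) ^ 2) := by
        rw [← Real.sqrt_eq_rpow, Real.sqrt_div hm.le]
        ring
    _ = C * (m / (k + 1)) ^ (a - 1 / 2) * Real.exp (-(√k - √m) ^ 2) := by
        rw [← Real.rpow_add (by positivity)]
        ring_nf

theorem exists_rpow_mul_exp_neg_sq_le (A : ℝ) {c : ℝ} (hc : 0 < c) :
    ∃ C, 0 ≤ C ∧ ∀ t : ℝ, 0 ≤ t → (1 + t) ^ A * Real.exp (-(c * t ^ 2)) ≤ C := by
  obtain ⟨N, hN⟩ := exists_nat_ge A
  refine ⟨N.factorial * Real.exp (1 + 1 / (4 * c)), by positivity, fun t ht => ?_⟩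
  have hpow : (1 + t) ^ A ≤ Real.exp (1 + t) * N.factorial := by
    refine (Real.rpow_le_rpow_of_exponent_le (by linarith) hN).trans ?_
    rw [Real.rpow_natCast, ← div_le_iff₀ (by positivity)]
    exact Real.pow_div_factorial_le_exp (1 + t) (by linarith) N
  have hsquare : 1 + t - c * t ^ 2 = 1 + 1 / (4 * c) - c * (t - 1 / (2 * c)) ^ 2 := by
    field_simp
    ring
  calc (1 + t) ^ A * Real.exp (-(c * t ^ 2))
      ≤ (Real.exp (1 + t) * N.factorial) * Real.exp (-(c * t ^ 2)) := by gcongr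
    _ = N.factorial * Real.exp (1 + t - c * t ^ 2) := by
        rw [sub_eq_add_neg, Real.exp_add (1 + t)]
        ring
    _ ≤ N.factorial * Real.exp (1 + 1 / (4 * c)) := by
        rw [hsquare]
        gcongr
        exact sub_le_self _ (by positivity)

theorem rpow_le_rpow_abs {t B : ℝ} (e : ℝ) (ht : 0 < t) (hB : t ≤ B) (hB' : t⁻¹ ≤ B) :
    t ^ e ≤ B ^ |e| := by
  rcases le_total 0 e with he | he
  · rw [abs_of_nonneg he]
    exact Real.rpow_le_rpow ht.le hB he
  · rw [abs_of_nonpos he, ← inv_inv t, Real.inv_rpow (by positivity),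
      ← Real.rpow_neg (by positivity)]
    exact Real.rpow_le_rpow (by positivity) hB' (by linarith)

theorem div_succ_le_two_mul_one_add_abs_sq {m : ℝ} (hm : 0 < m) (k : ℕ) :
    m / (k + 1) ≤ 2 * (1 + |((k : ℝ) - m) / √m|) ^ 2 := by
  have hs := Real.sqrt_pos.2 hm
  set x := |((k : ℝ) - m) / √m| with hx
  have : 0 ≤ x := abs_nonneg _
  have hdist : m ≤ k + x * √m := by
    rw [hx, abs_div, abs_of_pos hs, div_mul_cancel₀ _ hs.ne']
    linarith [neg_abs_le ((k : ℝ) - m)]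
  have hsq : m ≤ 2 * k + x ^ 2 := by
    linarith [two_mul_le_add_sq x √m, Real.sq_sqrt hm.le]
  rw [div_le_iff₀ (by positivity)]
  calc m ≤ 2 * k + x ^ 2 := hsq
    _ ≤ 2 * k + x ^ 2 + (2 + 4 * x * (k + 1) + x ^ 2 * (2 * k + 1)) :=
        le_add_of_nonneg_right (by positivity)
    _ = 2 * (1 + x) ^ 2 * (k + 1) := by ring

theorem sq_sub_div_sqrt_le {m L : ℝ} (hm : 0 < m) {k : ℕ} (hk : (k : ℝ) ≤ L * m) :
    (((k : ℝ) - m) / √m) ^ 2 ≤ (√L + 1) ^ 2 * (√k - √m) ^ 2 := by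
  have hs := Real.sqrt_pos.2 hm
  have hsum : (√k + √m) / √m ≤ √L + 1 := by
    rw [div_le_iff₀ hs, add_mul, one_mul, ← Real.sqrt_mul' _ hm.le]
    gcongr
  calc (((k : ℝ) - m) / √m) ^ 2 = ((√k + √m) / √m) ^ 2 * (√k - √m) ^ 2 := by
        rw [← mul_pow, div_mul_eq_mul_div, ← sq_sub_sq, Real.sq_sqrt k.cast_nonneg,
          Real.sq_sqrt hm.le]
    _ ≤ (√L + 1) ^ 2 * (√k - √m) ^ 2 := by gcongr

theorem exists_div_succ_rpow_le (p : ℝ) {m₀ L : ℝ} (hm₀ : 0 < m₀) (hL : 0 ≤ L) :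
    ∃ C, 0 ≤ C ∧ ∀ m : ℝ, m₀ ≤ m → ∀ k : ℕ, (k : ℝ) ≤ L * m →
      (m / (k + 1)) ^ p ≤ C * (1 + |((k : ℝ) - m) / √m|) ^ (2 * |p|) := by
  let B := L + 1 / m₀ + 2
  have hB : 0 ≤ B := by positivity
  refine ⟨B ^ |p|, by positivity, fun m hm k hk => ?_⟩
  have hm' : 0 < m := hm₀.trans_le hm
  let x := |((k : ℝ) - m) / √m|
  have hx : 0 ≤ x := abs_nonneg _
  rw [Real.rpow_mul (by positivity), Real.rpow_two, ← Real.mul_rpow hB (by positivity)]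
  refine rpow_le_rpow_abs _ (by positivity)
    ((div_succ_le_two_mul_one_add_abs_sq hm' k).trans ?_) ?_
  · gcongr
    exact le_add_of_nonneg_left (by positivity)
  · calc (m / (k + 1))⁻¹ = k / m + 1 / m := by rw [inv_div, add_div]
      _ ≤ L + 1 / m₀ := by
        gcongr
        exact (div_le_iff₀ hm').2 hk
      _ ≤ B * 1 := by
        rw [mul_one]
        exact le_add_of_nonneg_right zero_le_two
      _ ≤ B * (1 + x) ^ 2 := by
        gcongr
        exact one_le_pow₀ (le_add_of_nonneg_right hx)

theorem exists_gammaWeight_le {a : ℝ} (ha : 0 < a) (A : ℝ) {m₀ L : ℝ} (hm₀ : 0 < m₀)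
    (hL : 0 ≤ L) :
    ∃ C, 0 ≤ C ∧ ∀ m : ℝ, m₀ ≤ m → ∀ k : ℕ, (k : ℝ) ≤ L * m →
      gammaWeight a m k ≤ C * (1 + |((k : ℝ) - m) / √m|) ^ (-A) := by
  let p := a - 1 / 2
  obtain ⟨C₁, hC₁, hweight⟩ := exists_gammaWeight_le_rpow_mul_exp ha
  obtain ⟨C₂, hC₂, hratio⟩ := exists_div_succ_rpow_le p hm₀ hL
  obtain ⟨C₃, hC₃, hgauss⟩ := exists_rpow_mul_exp_neg_sq_le (2 * |p| + A)
    (c := ((√L + 1) ^ 2)⁻¹) (by positivity)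
  refine ⟨C₁ * C₂ * C₃, by positivity, fun m hm k hk => ?_⟩
  have hm' : 0 < m := hm₀.trans_le hm
  let x := |((k : ℝ) - m) / √m|
  have hx : 0 ≤ x := abs_nonneg _
  have hexp : Real.exp (-(√k - √m) ^ 2) ≤ Real.exp (-(((√L + 1) ^ 2)⁻¹ * x ^ 2)) := by
    gcongr
    rw [inv_mul_le_iff₀ (by positivity), sq_abs]
    exact sq_sub_div_sqrt_le hm' hk
  rw [Real.rpow_neg (by positivity), ← div_eq_mul_inv, le_div_iff₀ (by positivity)]
  calc gammaWeight a m k * (1 + x) ^ A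
      ≤ C₁ * (C₂ * (1 + x) ^ (2 * |p|)) * Real.exp (-(((√L + 1) ^ 2)⁻¹ * x ^ 2)) *
          (1 + x) ^ A := by
        gcongr
        refine (hweight m hm' k).trans ?_
        gcongr
        exact hratio m hm k hk
    _ = C₁ * C₂ * ((1 + x) ^ (2 * |p| + A) * Real.exp (-(((√L + 1) ^ 2)⁻¹ * x ^ 2))) := by
        rw [Real.rpow_add (by positivity)]
        ring
    _ ≤ C₁ * C₂ * C₃ := by
        gcongr
        exact hgauss x hx

end UniformBounds

section HookProducts

theorem rowLen_eq_zero_of_colLen_le {μ : YoungDiagram} {d i : ℕ} (h : μ.colLen 0 ≤ d)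
    (hi : d ≤ i) : μ.rowLen i = 0 := by
  by_contra h0
  have hmem := YoungDiagram.mem_iff_lt_rowLen.2 (Nat.pos_of_ne_zero h0)
  exact absurd (YoungDiagram.mem_iff_lt_colLen.1 hmem) (h.trans hi).not_gt

@[to_additive]
theorem prod_cells_eq_prod_rows {M : Type*} [CommMonoid M] {μ : YoungDiagram} {d : ℕ}
    (h : μ.colLen 0 ≤ d) (f : ℕ × ℕ → M) :
    ∏ c ∈ μ.cells, f c = ∏ i : Fin d, ∏ j ∈ Finset.range (μ.rowLen i), f (i, j) := by
  rw [← Finset.prod_range fun i => ∏ j ∈ Finset.range (μ.rowLen i), f (i, j)]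
  refine Finset.prod_finset_product _ _ _ fun c => ?_
  rw [YoungDiagram.mem_cells, Finset.mem_range, Finset.mem_range, ← YoungDiagram.mem_iff_lt_rowLen]
  refine (and_iff_right_of_imp fun hc => ?_).symm
  by_contra hd
  have := YoungDiagram.mem_iff_lt_rowLen.1 hc
  rw [rowLen_eq_zero_of_colLen_le h (not_lt.1 hd)] at this
  exact Nat.not_lt_zero _ this

theorem card_eq_sum_rowLen {μ : YoungDiagram} {d : ℕ} (h : μ.colLen 0 ≤ d) :
    μ.card = ∑ i : Fin d, μ.rowLen i := by
  rw [YoungDiagram.card, Finset.card_eq_sum_ones, sum_cells_eq_sum_rows h]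
  simp

theorem colLen_eq_of_rowLen {μ : YoungDiagram} {k j : ℕ} (hj : μ.rowLen (k + 1) ≤ j)
    (hj' : j < μ.rowLen k) : μ.colLen j = k + 1 := by
  refine le_antisymm (not_lt.1 fun h => ?_)
    (YoungDiagram.mem_iff_lt_colLen.1 (YoungDiagram.mem_iff_lt_rowLen.2 hj'))
  exact hj.not_gt (YoungDiagram.mem_iff_lt_rowLen.1 (YoungDiagram.mem_iff_lt_colLen.2 h))

theorem prod_Ico_sub_add_eq_Gamma_div {t : ℝ} (ht : 0 < t) {a b L : ℕ} (hab : a ≤ b)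
    (hbL : b ≤ L) :
    ∏ j ∈ Finset.Ico a b, ((L : ℝ) - (j + 1) + t) =
      Real.Gamma ((L : ℝ) - a + t) / Real.Gamma ((L : ℝ) - b + t) := by
  induction b, hab using Nat.le_induction with
  | base =>
    have : (0 : ℝ) ≤ L - a := sub_nonneg.2 (Nat.cast_le.2 hbL)
    rw [Finset.Ico_self, Finset.prod_empty, div_self (by positivity)]
  | succ b hab ih =>
    have hpos : 0 < (L : ℝ) - (b + 1) + t :=
      add_pos_of_nonneg_of_pos (sub_nonneg.2 (by exact_mod_cast hbL)) ht
    have hΓ := Real.Gamma_add_one hpos.ne'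
    rw [show (L : ℝ) - (b + 1) + t + 1 = L - b + t by ring] at hΓ
    rw [Finset.prod_Ico_succ_top hab, ih (by omega), hΓ, Nat.cast_add_one]
    field_simp

/-- The hook product `∏ (arm + θ leg + s)`. Both `c_λ(α)` and `c'_λ(α)` are of this form up to a
power of `α`, with `θ = 1 / α` and `s` equal to `1 / α` and `1` respectively. -/
noncomputable def hookProduct (θ s : ℝ) (μ : YoungDiagram) : ℝ :=
  ∏ c ∈ μ.cells, (armLength μ c + θ * legLength μ c + s)

theorem jackHookLower_eq {α : ℝ} (hα : α ≠ 0) (μ : YoungDiagram) :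
    jackHookLower α μ = α ^ μ.card * hookProduct (1 / α) (1 / α) μ := by
  rw [jackHookLower, hookProduct, YoungDiagram.card, Finset.pow_card_mul_prod]
  refine Finset.prod_congr rfl fun c _ => ?_
  field_simp

theorem jackHookUpper_eq {α : ℝ} (hα : α ≠ 0) (μ : YoungDiagram) :
    jackHookUpper α μ = α ^ μ.card * hookProduct (1 / α) 1 μ := by
  rw [jackHookUpper, hookProduct, YoungDiagram.card, Finset.pow_card_mul_prod]
  refine Finset.prod_congr rfl fun c _ => ?_
  field_simp

theorem prod_hook_of_colLen_const (μ : YoungDiagram) {θ s : ℝ} (hθ : 0 ≤ θ) (hs : 0 < s)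
    {i k : ℕ} (hik : i ≤ k) :
    ∏ j ∈ Finset.Ico (μ.rowLen (k + 1)) (μ.rowLen k),
        (armLength μ (i, j) + θ * legLength μ (i, j) + s) =
      Real.Gamma ((μ.rowLen i : ℝ) - μ.rowLen (k + 1) + (s + θ * (Finset.Ioc i k).card)) /
        Real.Gamma ((μ.rowLen i : ℝ) - μ.rowLen k + (s + θ * (Finset.Ioc i k).card)) := by
  rw [← prod_Ico_sub_add_eq_Gamma_div (by positivity) (μ.rowLen_anti _ _ k.le_succ)
    (μ.rowLen_anti _ _ hik)]
  refine Finset.prod_congr rfl fun j hj => ?_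
  rw [Finset.mem_Ico] at hj
  rw [armLength, legLength, colLen_eq_of_rowLen hj.1 hj.2, Nat.card_Ioc, Nat.cast_sub hik]
  push_cast
  ring

theorem prod_hook_row_from (μ : YoungDiagram) {θ s : ℝ} (hθ : 0 ≤ θ) (hs : 0 < s)
    {i k : ℕ} (hik : i + 1 ≤ k) :
    ∏ j ∈ Finset.Ico (μ.rowLen k) (μ.rowLen i),
        (armLength μ (i, j) + θ * legLength μ (i, j) + s) =
      Real.Gamma ((μ.rowLen i : ℝ) - μ.rowLen k + (s + θ * (Finset.Ioo i k).card)) /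
          Real.Gamma s *
        ∏ l ∈ Finset.Ioo i k,
          (Real.Gamma ((μ.rowLen i : ℝ) - μ.rowLen l + (s + θ * (Finset.Ioo i l).card)) /
            Real.Gamma ((μ.rowLen i : ℝ) - μ.rowLen l + (s + θ * (Finset.Ioo i l).card + θ))) := by
  induction k, hik using Nat.le_induction with
  | base =>
    rw [prod_hook_of_colLen_const μ hθ hs le_rfl,
      Finset.Ioo_add_one_right_eq_Ioc, Finset.Ioc_self]
    simp
  | succ k hik ih =>
    have hle := μ.rowLen_anti i k (by omega)
    have hΓ : 0 < Real.Gamma ((μ.rowLen i : ℝ) - μ.rowLen k + (s + θ * (Finset.Ioc i k).card)) :=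
      have : (0 : ℝ) ≤ (μ.rowLen i : ℝ) - μ.rowLen k := sub_nonneg.2 (Nat.cast_le.2 hle)
      by positivity
    have hcard : s + θ * (Finset.Ioo i k).card + θ = s + θ * (Finset.Ioc i k).card := by
      rw [Finset.Ioc_eq_cons_Ioo (by omega), Finset.card_cons, Nat.cast_add_one]
      ring
    rw [← Finset.prod_Ico_consecutive _ (μ.rowLen_anti _ _ k.le_succ) hle, ih,
      prod_hook_of_colLen_const μ hθ hs (by omega), Finset.Ioo_add_one_right_eq_Ioc,
      Finset.Ioc_eq_cons_Ioo (by omega),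
      Finset.prod_cons, ← Finset.Ioc_eq_cons_Ioo (by omega), hcard]
    field_simp

theorem hookProduct_eq_prod_Gamma {μ : YoungDiagram} {d : ℕ} (hμ : μ.colLen 0 ≤ d) {θ s : ℝ}
    (hθ : 0 ≤ θ) (hs : 0 < s) :
    hookProduct θ s μ = ∏ i : Fin d,
      (Real.Gamma (μ.rowLen i + (s + θ * (Finset.Ioi i).card)) / Real.Gamma s *
        ∏ j ∈ Finset.Ioi i,
          (Real.Gamma ((μ.rowLen i - μ.rowLen j : ℕ) + (s + θ * (Finset.Ioo i j).card)) /
            Real.Gamma ((μ.rowLen i - μ.rowLen j : ℕ) + (s + θ * (Finset.Ioo i j).card + θ)))) := by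
  rw [hookProduct, prod_cells_eq_prod_rows hμ]
  refine Finset.prod_congr rfl fun i _ => ?_
  have hrow := prod_hook_row_from μ hθ hs i.is_lt
  rw [rowLen_eq_zero_of_colLen_le hμ le_rfl, Nat.Ico_zero_eq_range, Nat.cast_zero, sub_zero] at hrow
  rw [hrow, ← Fin.map_valEmbedding_Ioi, Finset.prod_map, Finset.card_map]
  congr 1
  refine Finset.prod_congr rfl fun j hj => ?_
  rw [Nat.cast_sub (μ.rowLen_anti _ _ (Fin.le_def.1 (Finset.mem_Ioi.1 hj).le)),
    Fin.valEmbedding_apply, ← Fin.map_valEmbedding_Ioo, Finset.card_map]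

/-- The weakly decreasing vectors of `d` natural numbers with sum `n`; they are the row lengths
of the partitions of `n` with at most `d` parts. -/
def antitoneCompositions (n d : ℕ) : Finset (Fin d → ℕ) :=
  open Classical in (Finset.piAntidiag Finset.univ n).filter Antitone

theorem mem_antitoneCompositions {n d : ℕ} {v : Fin d → ℕ} :
    v ∈ antitoneCompositions n d ↔ ∑ i, v i = n ∧ Antitone v := by
  simp [antitoneCompositions]

theorem le_of_mem_antitoneCompositions {n d : ℕ} {v : Fin d → ℕ}
    (hv : v ∈ antitoneCompositions n d) (i : Fin d) : v i ≤ n :=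
  (mem_antitoneCompositions.1 hv).1 ▸ Finset.single_le_sum_of_canonicallyOrdered
    (Finset.mem_univ i)

theorem eq_of_rowLen_eq {μ ν : YoungDiagram} {d : ℕ} (hμ : μ.colLen 0 ≤ d) (hν : ν.colLen 0 ≤ d)
    (h : ∀ i : Fin d, μ.rowLen i = ν.rowLen i) : μ = ν := by
  have hrow (i : ℕ) : μ.rowLen i = ν.rowLen i := by
    rcases lt_or_ge i d with hi | hi
    · exact h ⟨i, hi⟩
    · rw [rowLen_eq_zero_of_colLen_le hμ hi, rowLen_eq_zero_of_colLen_le hν hi]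
  ext ⟨i, j⟩
  rw [YoungDiagram.mem_cells, YoungDiagram.mem_cells, YoungDiagram.mem_iff_lt_rowLen,
    YoungDiagram.mem_iff_lt_rowLen, hrow]

theorem exists_rowLen_eq {d : ℕ} {v : Fin d → ℕ} (hv : Antitone v) :
    ∃ μ : YoungDiagram, μ.colLen 0 ≤ d ∧ ∀ i : Fin d, μ.rowLen i = v i := by
  refine ⟨YoungDiagram.ofRowLens (List.ofFn v) hv.sortedGE_ofFn, not_lt.1 fun h => ?_, fun i => ?_⟩
  · have hmem := YoungDiagram.mem_iff_lt_colLen.2 h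
    simp [YoungDiagram.mem_ofRowLens] at hmem
  · simpa using YoungDiagram.rowLen_ofRowLens (hw := hv.sortedGE_ofFn)
      (Fin.cast List.length_ofFn.symm i)

theorem sum_partitionsOfLengthLE_eq {M : Type*} [AddCommMonoid M] {n d : ℕ}
    {f : YoungDiagram → M} {g : (Fin d → ℕ) → M}
    (h : ∀ μ ∈ partitionsOfLengthLE n d, f μ = g fun i => μ.rowLen i) :
    ∑ μ ∈ partitionsOfLengthLE n d, f μ = ∑ v ∈ antitoneCompositions n d, g v := by
  refine Finset.sum_bij (fun μ _ (i : Fin d) => μ.rowLen i) (fun μ hμ => ?_)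
    (fun μ hμ ν hν hrow => ?_) (fun v hv => ?_) h
  · obtain ⟨rfl, hlen⟩ := mem_partitionsOfLengthLE.1 hμ
    exact mem_antitoneCompositions.2
      ⟨(card_eq_sum_rowLen hlen).symm, fun i j hij => μ.rowLen_anti _ _ hij⟩
  · exact eq_of_rowLen_eq (mem_partitionsOfLengthLE.1 hμ).2 (mem_partitionsOfLengthLE.1 hν).2
      (congrFun hrow)
  · obtain ⟨hsum, hanti⟩ := mem_antitoneCompositions.1 hv
    obtain ⟨μ, hlen, hrow⟩ := exists_rowLen_eq hanti
    refine ⟨μ, mem_partitionsOfLengthLE.2 ⟨?_, hlen⟩, funext hrow⟩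
    rw [card_eq_sum_rowLen hlen, ← hsum, Finset.sum_congr rfl fun i _ => hrow i]

end HookProducts

section HookWeights

theorem sum_card_Ioi (d : ℕ) : ∑ i : Fin d, (Finset.Ioi i).card = d.choose 2 := by
  simp only [Fin.card_Ioi]
  rw [Fin.sum_univ_eq_sum_range (fun i => d - 1 - i),
    Finset.sum_range_reflect (fun i => i), Finset.sum_range_id, Nat.choose_two_right]

theorem prod_mul_prod_Ioi_mul_const {M : Type*} [CommMonoid M] {d : ℕ} (f : Fin d → M)
    (g : Fin d → Fin d → M) (a : M) :
    ∏ i, (f i * ∏ j ∈ Finset.Ioi i, (g i j * a)) =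
      (∏ i, (f i * ∏ j ∈ Finset.Ioi i, g i j)) * a ^ d.choose 2 := by
  simp only [Finset.prod_mul_distrib, Finset.prod_const, Finset.prod_pow_eq_pow_sum, sum_card_Ioi,
    mul_assoc]

/-- The inverse hook product as a function of the row lengths `v`, normalized so that it stays
bounded and converges when the rows fluctuate on the scale `r` about `m`. -/
noncomputable def hookWeight (θ s r m : ℝ) {d : ℕ} (v : Fin d → ℕ) : ℝ :=
  ∏ i, (gammaWeight (s + θ * (Finset.Ioi i).card) m (v i) *
    ∏ j ∈ Finset.Ioi i,
      (Real.Gamma ((v i - v j : ℕ) + (s + θ * (Finset.Ioo i j).card + θ)) /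
        Real.Gamma ((v i - v j : ℕ) + (s + θ * (Finset.Ioo i j).card)) / r ^ θ))

theorem hookWeight_nonneg {θ s r m : ℝ} (hθ : 0 ≤ θ) (hs : 0 < s) (hr : 0 ≤ r) (hm : 0 ≤ m) {d : ℕ}
    (v : Fin d → ℕ) : 0 ≤ hookWeight θ s r m v :=
  Finset.prod_nonneg fun i _ => mul_nonneg (gammaWeight_nonneg (by positivity) hm _) (by positivity)

theorem inv_hookProduct_eq {μ : YoungDiagram} {d : ℕ} (hμ : μ.colLen 0 ≤ d) {θ s r m : ℝ}
    (hθ : 0 ≤ θ) (hs : 0 < s) (hr : 0 < r) (hm : 0 < m) :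
    (hookProduct θ s μ)⁻¹ =
      Real.Gamma s ^ d * Real.exp (d * m) * m ^ (-(μ.card + d * (s - 1 / 2) + θ * d.choose 2)) *
        r ^ (θ * d.choose 2) * hookWeight θ s r m fun i : Fin d => μ.rowLen i := by
  have hrow (i : Fin d) :
      (Real.Gamma (μ.rowLen i + (s + θ * (Finset.Ioi i).card)) / Real.Gamma s *
        ∏ j ∈ Finset.Ioi i,
          (Real.Gamma ((μ.rowLen i - μ.rowLen j : ℕ) + (s + θ * (Finset.Ioo i j).card)) /
            Real.Gamma ((μ.rowLen i - μ.rowLen j : ℕ) +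
              (s + θ * (Finset.Ioo i j).card + θ))))⁻¹ =
      Real.Gamma s * Real.exp m * m ^ (-(μ.rowLen i + (s + θ * (Finset.Ioi i).card) - 1 / 2)) *
        (r ^ θ) ^ (Finset.Ioi i).card *
        (gammaWeight (s + θ * (Finset.Ioi i).card) m (μ.rowLen i) *
          ∏ j ∈ Finset.Ioi i,
            (Real.Gamma ((μ.rowLen i - μ.rowLen j : ℕ) + (s + θ * (Finset.Ioo i j).card + θ)) /
              Real.Gamma ((μ.rowLen i - μ.rowLen j : ℕ) + (s + θ * (Finset.Ioo i j).card)) /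
                r ^ θ)) := by
    simp only [Finset.prod_div_distrib, Finset.prod_const, gammaWeight, Real.exp_neg,
      Real.rpow_neg hm.le]
    field_simp
  have hexponent : ∑ i : Fin d, -(μ.rowLen i + (s + θ * (Finset.Ioi i).card) - 1 / 2) =
      -(μ.card + d * (s - 1 / 2) + θ * d.choose 2) := by
    rw [card_eq_sum_rowLen hμ, ← sum_card_Ioi]
    simp only [Finset.sum_neg_distrib, Finset.sum_sub_distrib, Finset.sum_add_distrib,
      Finset.sum_const, Finset.card_univ, Fintype.card_fin, nsmul_eq_mul, ← Finset.mul_sum]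
    push_cast
    ring
  rw [hookProduct_eq_prod_Gamma hμ hθ hs, ← Finset.prod_inv_distrib,
    Finset.prod_congr rfl fun i _ => hrow i, Finset.prod_mul_distrib, Finset.prod_mul_distrib,
    Finset.prod_mul_distrib, Finset.prod_mul_distrib, ← Real.rpow_sum_of_pos hm, hexponent,
    Finset.prod_pow_eq_pow_sum, sum_card_Ioi, Real.rpow_mul hr.le, Real.rpow_natCast,
    Real.exp_nat_mul, Finset.prod_const, Finset.prod_const, Finset.card_univ, Fintype.card_fin,
    hookWeight]

theorem natCast_tsub_eq_max (a b : ℕ) : ((a - b : ℕ) : ℝ) = max (a - b : ℝ) 0 := by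
  rcases le_total b a with h | h
  · rw [Nat.cast_sub h, max_eq_left (sub_nonneg.2 (Nat.cast_le.2 h))]
  · rw [Nat.sub_eq_zero_of_le h, Nat.cast_zero, max_eq_right (sub_nonpos.2 (Nat.cast_le.2 h))]

theorem tendsto_hookWeight {θ s c : ℝ} (hθ : 0 ≤ θ) (hs : 0 < s) (hc : 0 < c) {ι : Type*}
    {l : Filter ι} {m : ι → ℝ} (hm : Tendsto m l atTop) {d : ℕ} {v : ι → Fin d → ℕ} {x : Fin d → ℝ}
    (hx : StrictAnti x)
    (hv : ∀ i, Tendsto (fun n => ((v n i : ℝ) - m n) / (c * √(m n))) l (𝓝 (x i))) :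
    Tendsto (fun n => hookWeight θ s (c * √(m n)) (m n) (v n)) l
      (𝓝 (∏ i, (Real.exp (-((c * x i) ^ 2 / 2)) / √(2 * Real.pi) *
        ∏ j ∈ Finset.Ioi i, (x i - x j) ^ θ))) := by
  have hr : Tendsto (fun n => c * √(m n)) l atTop :=
    (Real.tendsto_sqrt_atTop.comp hm).const_mul_atTop hc
  have hrow (i : Fin d) : Tendsto (fun n => ((v n i : ℝ) - m n) / √(m n)) l (𝓝 (c * x i)) := by
    refine ((hv i).const_mul c).congr fun n => ?_
    rw [div_mul_eq_div_div_swap, mul_div_cancel₀ _ hc.ne']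
  have hpair (i j : Fin d) (hij : j ∈ Finset.Ioi i) :
      Tendsto (fun n => ((v n i - v n j : ℕ) : ℝ) / (c * √(m n))) l (𝓝 (x i - x j)) := by
    have hdiff := ((hv i).sub (hv j)).max (tendsto_const_nhds (x := (0 : ℝ)))
    rw [max_eq_left (sub_nonneg.2 (hx (Finset.mem_Ioi.1 hij)).le)] at hdiff
    refine hdiff.congr fun n => ?_
    rw [natCast_tsub_eq_max, ← max_div_div_right (by positivity), zero_div, ← sub_div,
      sub_sub_sub_cancel_right]
  refine tendsto_finsetProd _ fun i _ => (tendsto_gammaWeight (by positivity) hm (hrow i)).mul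
    (tendsto_finsetProd _ fun j hij => ?_)
  have hpos : 0 < x i - x j := sub_pos.2 (hx (Finset.mem_Ioi.1 hij))
  simpa only [add_sub_cancel_left] using tendsto_Gamma_div_Gamma_div_rpow
    (a := s + θ * (Finset.Ioo i j).card + θ) (b := s + θ * (Finset.Ioo i j).card)
    (by positivity) (by positivity) hpos hr (hpair i j hij)

theorem exists_gammaWeight_le_rescaled {a : ℝ} (ha : 0 < a) {A c m₀ L : ℝ} (hA : 0 ≤ A)
    (hc : 0 < c) (hm₀ : 0 < m₀) (hL : 0 ≤ L) :
    ∃ C, 0 ≤ C ∧ ∀ m : ℝ, m₀ ≤ m → ∀ k : ℕ, (k : ℝ) ≤ L * m →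
      gammaWeight a m k ≤ C * (1 + |((k : ℝ) - m) / (c * √m)|) ^ (-A) := by
  obtain ⟨C, hC, hbound⟩ := exists_gammaWeight_le ha A hm₀ hL
  refine ⟨C * (1 + 1 / c) ^ A, by positivity, fun m hm k hk => (hbound m hm k hk).trans ?_⟩
  have hrescale : (1 + |((k : ℝ) - m) / (c * √m)|) / (1 + 1 / c) ≤ 1 + |((k : ℝ) - m) / √m| := by
    rw [div_le_iff₀ (by positivity), div_mul_eq_div_div_swap, abs_div, abs_of_pos hc]
    calc 1 + |((k : ℝ) - m) / √m| / c
        ≤ 1 + |((k : ℝ) - m) / √m| / c + (|((k : ℝ) - m) / √m| + 1 / c) :=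
          le_add_of_nonneg_right (by positivity)
      _ = (1 + |((k : ℝ) - m) / √m|) * (1 + 1 / c) := by ring
  calc C * (1 + |((k : ℝ) - m) / √m|) ^ (-A)
      ≤ C * ((1 + |((k : ℝ) - m) / (c * √m)|) / (1 + 1 / c)) ^ (-A) :=
        mul_le_mul_of_nonneg_left
          (Real.rpow_le_rpow_of_nonpos (by positivity) hrescale (neg_nonpos.2 hA)) hC
    _ = C * (1 + 1 / c) ^ A * (1 + |((k : ℝ) - m) / (c * √m)|) ^ (-A) := by
        rw [Real.div_rpow (by positivity) (by positivity), Real.rpow_neg (x := 1 + 1 / c)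
          (by positivity), div_inv_eq_mul, mul_right_comm, mul_assoc C]

theorem exists_pair_Gamma_le {θ s c m₀ : ℝ} (hθ : 0 ≤ θ) (hs : 0 < s) (hc : 0 < c) (hm₀ : 0 < m₀) :
    ∃ C, 0 ≤ C ∧ ∀ m : ℝ, m₀ ≤ m → ∀ k l : ℕ,
      Real.Gamma ((k - l : ℕ) + (s + θ)) / Real.Gamma ((k - l : ℕ) + s) / (c * √m) ^ θ ≤
        C * ((1 + |((k : ℝ) - m) / (c * √m)|) * (1 + |((l : ℝ) - m) / (c * √m)|)) ^ θ := by
  obtain ⟨C, hC, hΓ⟩ := exists_Gamma_div_Gamma_le (a := s + θ) (b := s) (by positivity) hs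
  let B := 1 + 1 / (c * √m₀)
  refine ⟨C * B ^ θ, by positivity, fun m hm k l => ?_⟩
  have hr₀ : 0 < c * √m₀ := by positivity
  have hr : 0 < c * √m := hr₀.trans_le (by gcongr)
  let x := |((k : ℝ) - m) / (c * √m)|
  let y := |((l : ℝ) - m) / (c * √m)|
  have hx : 0 ≤ x := abs_nonneg _
  have hy : 0 ≤ y := abs_nonneg _
  have hgap : ((k - l : ℕ) : ℝ) / (c * √m) ≤ x + y := by
    rw [natCast_tsub_eq_max, ← max_div_div_right hr.le, zero_div]
    refine max_le ?_ (add_nonneg hx hy)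
    rw [← sub_sub_sub_cancel_right (k : ℝ) l m, sub_div]
    exact (le_abs_self _).trans (abs_sub _ _)
  have hbase : (((k - l : ℕ) : ℝ) + 1) / (c * √m) ≤ B * ((1 + x) * (1 + y)) := by
    calc (((k - l : ℕ) : ℝ) + 1) / (c * √m) ≤ x + y + 1 / (c * √m₀) := by
          rw [add_div]
          gcongr
      _ ≤ x + y + 1 / (c * √m₀) + (1 + x * y + 1 / (c * √m₀) * (x + y + x * y)) :=
          le_add_of_nonneg_right (by positivity)
      _ = B * ((1 + x) * (1 + y)) := by ring
  calc _ ≤ C * (((k - l : ℕ) : ℝ) + 1) ^ θ / (c * √m) ^ θ := by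
        gcongr
        simpa only [add_sub_cancel_left] using hΓ (k - l)
    _ = C * ((((k - l : ℕ) : ℝ) + 1) / (c * √m)) ^ θ := by
        rw [Real.div_rpow (by positivity) hr.le, mul_div_assoc]
    _ ≤ C * (B * ((1 + x) * (1 + y))) ^ θ := by gcongr
    _ = C * B ^ θ * ((1 + x) * (1 + y)) ^ θ := by
        rw [Real.mul_rpow (by positivity) (by positivity), mul_assoc]

theorem mul_le_prod_of_one_le {ι : Type*} [Fintype ι] {f : ι → ℝ}
    (hf : ∀ i, 1 ≤ f i) {i j : ι} (hij : i ≠ j) : f i * f j ≤ ∏ k, f k := by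
  classical
  rw [← Finset.prod_pair hij]
  exact Finset.prod_le_prod_of_subset_of_one_le (Finset.subset_univ _)
    (fun k _ => zero_le_one.trans (hf k)) fun k _ _ => hf k

theorem prod_mul_prod_Ioi_le_of_le {d : ℕ} {θ A : ℝ} (hθ : 0 ≤ θ) {w ξ C : Fin d → ℝ}
    {R D : Fin d → Fin d → ℝ} (hw : ∀ i, 0 ≤ w i) (hR : ∀ i j, 0 ≤ R i j) (hξ : ∀ i, 1 ≤ ξ i)
    (hC : ∀ i, 0 ≤ C i) (hD : ∀ i j, 0 ≤ D i j)
    (hwξ : ∀ i, w i ≤ C i * ξ i ^ (-(A + θ * d.choose 2)))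
    (hRξ : ∀ i j, R i j ≤ D i j * (ξ i * ξ j) ^ θ) :
    ∏ i, (w i * ∏ j ∈ Finset.Ioi i, R i j) ≤
      (∏ i, (C i * ∏ j ∈ Finset.Ioi i, D i j)) * (∏ i, ξ i) ^ (-A) := by
  have hξ_pos (i : Fin d) : 0 < ξ i := zero_lt_one.trans_le (hξ i)
  let P := ∏ i, ξ i
  have hP : 0 < P := Finset.prod_pos fun i _ => hξ_pos i
  have hRP (i j : Fin d) (hij : j ∈ Finset.Ioi i) : R i j ≤ D i j * P ^ θ :=
    (hRξ i j).trans (mul_le_mul_of_nonneg_left (Real.rpow_le_rpow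
      (mul_nonneg (hξ_pos i).le (hξ_pos j).le)
      (mul_le_prod_of_one_le hξ (Finset.mem_Ioi.1 hij).ne) hθ) (hD i j))
  have hprod_nonneg (i : Fin d) : 0 ≤ ∏ j ∈ Finset.Ioi i, R i j :=
    Finset.prod_nonneg fun j _ => hR i j
  calc ∏ i, (w i * ∏ j ∈ Finset.Ioi i, R i j)
      ≤ ∏ i, (C i * ξ i ^ (-(A + θ * d.choose 2)) * ∏ j ∈ Finset.Ioi i, D i j * P ^ θ) :=
        Finset.prod_le_prod (fun i _ => mul_nonneg (hw i) (hprod_nonneg i)) fun i _ =>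
          mul_le_mul (hwξ i) (Finset.prod_le_prod (fun j _ => hR i j) (hRP i))
            (hprod_nonneg i) (mul_nonneg (hC i) (Real.rpow_nonneg (hξ_pos i).le _))
    _ = (∏ i, (C i * ∏ j ∈ Finset.Ioi i, D i j)) *
          (P ^ (-(A + θ * d.choose 2)) * (P ^ θ) ^ d.choose 2) := by
        rw [prod_mul_prod_Ioi_mul_const, Finset.prod_congr rfl fun i _ => mul_right_comm _ _ _,
          Finset.prod_mul_distrib, Real.finsetProd_rpow _ _ fun i _ => (hξ_pos i).le, mul_assoc]
    _ = (∏ i, (C i * ∏ j ∈ Finset.Ioi i, D i j)) * P ^ (-A) := by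
        rw [← Real.rpow_mul_natCast hP.le, ← Real.rpow_add hP]
        ring_nf

theorem exists_hookWeight_le (d : ℕ) {θ s A c m₀ L : ℝ} (hθ : 0 ≤ θ) (hs : 0 < s) (hA : 0 ≤ A)
    (hc : 0 < c) (hm₀ : 0 < m₀) (hL : 0 ≤ L) :
    ∃ C, 0 ≤ C ∧ ∀ m : ℝ, m₀ ≤ m → ∀ v : Fin d → ℕ, (∀ i, (v i : ℝ) ≤ L * m) →
      hookWeight θ s (c * √m) m v ≤ C * (∏ i, (1 + |((v i : ℝ) - m) / (c * √m)|)) ^ (-A) := by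
  choose C hC hrow using fun i : Fin d => exists_gammaWeight_le_rescaled
    (a := s + θ * (Finset.Ioi i).card) (A := A + θ * d.choose 2) (by positivity) (by positivity) hc
    hm₀ hL
  choose D hD hpair using fun i j : Fin d => exists_pair_Gamma_le
    (s := s + θ * (Finset.Ioo i j).card) hθ (by positivity) hc hm₀
  refine ⟨∏ i, (C i * ∏ j ∈ Finset.Ioi i, D i j),
    Finset.prod_nonneg fun i _ => mul_nonneg (hC i) (Finset.prod_nonneg fun j _ => hD i j),
    fun m hm v hv => ?_⟩
  have hm_nonneg : 0 ≤ m := hm₀.le.trans hm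
  exact prod_mul_prod_Ioi_le_of_le hθ (fun i => gammaWeight_nonneg (by positivity) hm_nonneg _)
    (fun i j => by positivity) (fun i => le_add_of_nonneg_right (abs_nonneg _)) hC hD
    (fun i => hrow i m hm (v i) (hv i)) fun i j => hpair i j m hm (v i) (v j)

end HookWeights

section TracelessExtend

variable {e : ℕ}

theorem tracelessExtend_castSucc (y : Fin e → ℝ) (i : Fin e) :
    tracelessExtend (e + 1) y i.castSucc = y i :=
  dif_pos i.2

theorem tracelessExtend_last (y : Fin e → ℝ) :
    tracelessExtend (e + 1) y (Fin.last e) = -∑ i, y i :=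
  dif_neg (lt_irrefl e)

theorem sum_tracelessExtend (y : Fin e → ℝ) : ∑ i, tracelessExtend (e + 1) y i = 0 := by
  simp only [Fin.sum_univ_castSucc, tracelessExtend_castSucc, tracelessExtend_last, add_neg_cancel]

theorem tracelessExtend_castSucc_of_sum_eq_zero {x : Fin (e + 1) → ℝ} (hx : ∑ i, x i = 0) :
    tracelessExtend (e + 1) (fun i => x i.castSucc) = x := by
  funext i
  induction i using Fin.lastCases with
  | cast i => rw [tracelessExtend_castSucc]
  | last => rw [tracelessExtend_last, neg_eq_iff_add_eq_zero, ← Fin.sum_univ_castSucc, hx]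

theorem abs_tracelessExtend_le (y : Fin e → ℝ) (i : Fin (e + 1)) :
    |tracelessExtend (e + 1) y i| ≤ ∑ k, |y k| := by
  induction i using Fin.lastCases with
  | cast i =>
    rw [tracelessExtend_castSucc]
    exact Finset.single_le_sum (f := fun k => |y k|) (fun _ _ => abs_nonneg _) (Finset.mem_univ i)
  | last =>
    rw [tracelessExtend_last, abs_neg]
    exact Finset.abs_sum_le_sum_abs _ _

/-- `tracelessExtend` as a linear map. -/
noncomputable def tracelessExtendLinear (e : ℕ) : (Fin e → ℝ) →ₗ[ℝ] Fin (e + 1) → ℝ where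
  toFun := tracelessExtend (e + 1)
  map_add' y z := by
    funext i
    induction i using Fin.lastCases with
    | cast i => simp only [tracelessExtend_castSucc, Pi.add_apply]
    | last => simp only [tracelessExtend_last, Pi.add_apply, Finset.sum_add_distrib, neg_add]
  map_smul' c y := by
    funext i
    induction i using Fin.lastCases with
    | cast i => simp only [tracelessExtend_castSucc, Pi.smul_apply, RingHom.id_apply]
    | last =>
      simp only [tracelessExtend_last, Pi.smul_apply, smul_eq_mul, ← Finset.mul_sum,
        RingHom.id_apply, mul_neg]

theorem continuous_tracelessExtend (i : Fin (e + 1)) :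
    Continuous fun y : Fin e → ℝ => tracelessExtend (e + 1) y i :=
  (continuous_apply i).comp (tracelessExtendLinear e).continuous_of_finiteDimensional

/-- The domain of integration of `regevIntegral (e + 1)`. -/
def chamberDomain (e : ℕ) : Set (Fin e → ℝ) :=
  {y | tracelessExtend (e + 1) y ∈ tracelessChamber (e + 1)}

theorem mem_chamberDomain {y : Fin e → ℝ} :
    y ∈ chamberDomain e ↔ Antitone (tracelessExtend (e + 1) y) :=
  and_iff_left (sum_tracelessExtend y)

theorem exists_strictAnti_tracelessExtend (e : ℕ) :
    ∃ y : Fin e → ℝ, StrictAnti (tracelessExtend (e + 1) y) := by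
  let x : Fin (e + 1) → ℝ := fun i => (i.rev : ℕ) - (i : ℕ)
  have hx : ∑ i, x i = 0 := by
    rw [Finset.sum_sub_distrib, sub_eq_zero]
    exact Equiv.sum_comp Fin.revPerm fun i : Fin (e + 1) => ((i : ℕ) : ℝ)
  refine ⟨fun i => x i.castSucc, (tracelessExtend_castSucc_of_sum_eq_zero hx).symm ▸ ?_⟩
  intro i j hij
  have hrev : ((j.rev : ℕ) : ℝ) < (i.rev : ℕ) := Nat.cast_lt.2 (Fin.rev_lt_rev.2 hij)
  have hval : ((i : ℕ) : ℝ) < (j : ℕ) := Nat.cast_lt.2 hij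
  exact sub_lt_sub hrev hval

theorem ae_tracelessExtend_injective :
    ∀ᵐ y : Fin e → ℝ, Function.Injective (tracelessExtend (e + 1) y) := by
  obtain ⟨z, hz⟩ := exists_strictAnti_tracelessExtend e
  have hne (i j : Fin (e + 1)) (hij : i ≠ j) :
      ∀ᵐ y : Fin e → ℝ, tracelessExtend (e + 1) y i ≠ tracelessExtend (e + 1) y j := by
    let f := (LinearMap.proj (R := ℝ) (φ := fun _ => ℝ) i - LinearMap.proj j) ∘ₗ
      tracelessExtendLinear e
    have hker : LinearMap.ker f ≠ ⊤ := fun htop =>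
      hij (hz.injective (sub_eq_zero.1 (LinearMap.mem_ker.1 (htop ▸ Submodule.mem_top :
        z ∈ LinearMap.ker f))))
    refine measure_mono_null (fun y hy => ?_) (Measure.addHaar_submodule volume _ hker)
    exact LinearMap.mem_ker.2 (sub_eq_zero.2 (not_not.1 hy))
  have hall : ∀ᵐ y : Fin e → ℝ, ∀ i j, i ≠ j →
      tracelessExtend (e + 1) y i ≠ tracelessExtend (e + 1) y j := by
    simpa only [ae_all_iff] using hne
  filter_upwards [hall] with y hy i j
  exact not_imp_not.1 (hy i j)

theorem measurableSet_chamberDomain (e : ℕ) : MeasurableSet (chamberDomain e) := by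
  have hset : chamberDomain e = {y | Antitone (tracelessExtend (e + 1) y)} :=
    Set.ext fun _ => mem_chamberDomain
  simp only [hset, Antitone, Set.ofPred_forall]
  exact (isClosed_iInter fun i => isClosed_iInter fun j => isClosed_iInter fun _ =>
    isClosed_le (continuous_tracelessExtend j) (continuous_tracelessExtend i)).measurableSet

theorem isOpen_strictAnti_tracelessExtend :
    IsOpen {y : Fin e → ℝ | StrictAnti (tracelessExtend (e + 1) y)} := by
  simp only [StrictAnti, Set.ofPred_forall]
  exact isOpen_iInter_of_finite fun i => isOpen_iInter_of_finite fun j =>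
    isOpen_iInter_of_finite fun _ =>
      isOpen_lt (continuous_tracelessExtend j) (continuous_tracelessExtend i)

end TracelessExtend

section LatticePoints

variable {e n : ℕ} {r : ℝ}

/-- The integer vector with coordinate sum `n` obtained by rounding down the first `e` coordinates
of `n / (e + 1) + r • tracelessExtend (e + 1) y`. -/
noncomputable def latticePoint (r : ℝ) (n : ℕ) (y : Fin e → ℝ) : Fin (e + 1) → ℤ :=
  Fin.snoc (α := fun _ => ℤ) (fun i => ⌊(n : ℝ) / (e + 1 : ℕ) + r * y i⌋)
    (n - ∑ i, ⌊(n : ℝ) / (e + 1 : ℕ) + r * y i⌋)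

theorem latticePoint_castSucc (y : Fin e → ℝ) (i : Fin e) :
    latticePoint r n y i.castSucc = ⌊(n : ℝ) / (e + 1 : ℕ) + r * y i⌋ :=
  Fin.snoc_castSucc (α := fun _ => ℤ) _ _ i

theorem sum_latticePoint (y : Fin e → ℝ) : ∑ i, latticePoint r n y i = n := by
  rw [Fin.sum_univ_castSucc, Finset.sum_congr rfl fun i _ => latticePoint_castSucc y i,
    latticePoint, Fin.snoc_last, add_sub_cancel]

theorem abs_latticePoint_sub_le (hr : 0 < r) (y : Fin e → ℝ) (i : Fin (e + 1)) :
    |((latticePoint r n y i : ℝ) - n / (e + 1 : ℕ)) / r - tracelessExtend (e + 1) y i| ≤ e / r := by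
  let x : Fin (e + 1) → ℝ := fun i =>
    ((latticePoint r n y i : ℝ) - n / (e + 1 : ℕ)) / r - tracelessExtend (e + 1) y i
  have hx : ∑ i, x i = 0 := by
    simp only [x, Finset.sum_sub_distrib, sum_tracelessExtend, ← Finset.sum_div, ← Int.cast_sum,
      sum_latticePoint, Finset.sum_const, Finset.card_univ, Fintype.card_fin, nsmul_eq_mul]
    rw [mul_div_cancel_left₀ _ (Nat.cast_ne_zero.2 e.succ_ne_zero), Int.cast_natCast, sub_self,
      zero_div, sub_zero]
  have hround (k : Fin e) : |x k.castSucc| ≤ 1 / r := by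
    have hfloor := Int.floor_le ((n : ℝ) / (e + 1 : ℕ) + r * y k)
    have hfloor' := Int.lt_floor_add_one ((n : ℝ) / (e + 1 : ℕ) + r * y k)
    simp only [x, latticePoint_castSucc, tracelessExtend_castSucc]
    rw [div_sub' hr.ne', abs_div, abs_of_pos hr]
    gcongr
    exact abs_le.2 ⟨by linarith, by linarith⟩
  calc |x i| = |tracelessExtend (e + 1) (fun k => x k.castSucc) i| := by
        rw [tracelessExtend_castSucc_of_sum_eq_zero hx]
    _ ≤ ∑ k : Fin e, |x k.castSucc| := abs_tracelessExtend_le _ i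
    _ ≤ ∑ _k : Fin e, 1 / r := Finset.sum_le_sum fun k _ => hround k
    _ = e / r := by
        rw [Finset.sum_const, Finset.card_univ, Fintype.card_fin, nsmul_eq_mul, mul_one_div]

theorem setOf_latticePoint_eq (hr : 0 < r) {v : Fin (e + 1) → ℤ} (hv : ∑ i, v i = n) :
    {y : Fin e → ℝ | latticePoint r n y = v} =
      Set.univ.pi fun i => Set.Ico (((v i.castSucc : ℝ) - n / (e + 1 : ℕ)) / r)
        (((v i.castSucc : ℝ) + 1 - n / (e + 1 : ℕ)) / r) := by
  have hinit (y : Fin e → ℝ) : latticePoint r n y = v ↔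
      ∀ i : Fin e, latticePoint r n y i.castSucc = v i.castSucc := by
    refine ⟨fun h i => congrFun h _, fun h => ?_⟩
    have hsum := (sum_latticePoint (r := r) y).trans hv.symm
    rw [Fin.sum_univ_castSucc, Fin.sum_univ_castSucc, Finset.sum_congr rfl fun i _ => h i,
      add_right_inj] at hsum
    exact funext fun i => Fin.lastCases hsum h i
  ext y
  simp only [Set.mem_ofPred_eq, hinit, Set.mem_univ_pi, Set.mem_Ico, div_le_iff₀ hr, lt_div_iff₀ hr,
    latticePoint_castSucc, Int.floor_eq_iff, sub_le_iff_le_add, lt_sub_iff_add_lt, mul_comm r,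
    add_comm]

theorem measurableSet_latticePoint_eq (hr : 0 < r) {v : Fin (e + 1) → ℤ} (hv : ∑ i, v i = n) :
    MeasurableSet {y : Fin e → ℝ | latticePoint r n y = v} := by
  rw [setOf_latticePoint_eq hr hv]
  exact MeasurableSet.univ_pi fun _ => measurableSet_Ico

theorem volume_latticePoint_eq (hr : 0 < r) {v : Fin (e + 1) → ℤ} (hv : ∑ i, v i = n) :
    volume {y : Fin e → ℝ | latticePoint r n y = v} = ENNReal.ofReal (r⁻¹ ^ e) := by
  have hlength (a b : ℝ) : (a + 1 - b) / r - (a - b) / r = r⁻¹ := by ring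
  simp only [setOf_latticePoint_eq hr hv, Real.volume_pi_Ico, hlength, Finset.prod_const,
    Finset.card_univ, Fintype.card_fin, ENNReal.ofReal_pow (inv_nonneg.2 hr.le)]

/-- The step function on `Fin e → ℝ` equal to `W v` where `latticePoint r n` is the composition `v`,
and to zero where `latticePoint r n` is not an antitone composition of `n`. -/
noncomputable def latticeStep (W : (Fin (e + 1) → ℕ) → ℝ) (r : ℝ) (n : ℕ) (y : Fin e → ℝ) : ℝ :=
  ∑ v ∈ antitoneCompositions n (e + 1),
    {y : Fin e → ℝ | latticePoint r n y = fun i => (v i : ℤ)}.indicator (fun _ => W v) y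

variable {W : (Fin (e + 1) → ℕ) → ℝ} {y : Fin e → ℝ}

theorem latticeStep_eq {v : Fin (e + 1) → ℕ} (hv : v ∈ antitoneCompositions n (e + 1))
    (hy : latticePoint r n y = fun i => (v i : ℤ)) : latticeStep W r n y = W v := by
  rw [latticeStep, Finset.sum_eq_single_of_mem v hv]
  · exact Set.indicator_of_mem (s := {y | latticePoint r n y = _}) hy _
  · refine fun w _ hwv => Set.indicator_of_notMem (fun hw => hwv ?_) _
    exact funext fun i => Nat.cast_injective (congrFun ((Eq.symm hw).trans hy) i)

theorem latticeStep_eq_zero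
    (h : ∀ v ∈ antitoneCompositions n (e + 1), latticePoint r n y ≠ fun i => (v i : ℤ)) :
    latticeStep W r n y = 0 :=
  Finset.sum_eq_zero fun v hv =>
    Set.indicator_of_notMem (s := {y | latticePoint r n y = _}) (h v hv) _

theorem sum_intCast_of_mem_antitoneCompositions {v : Fin (e + 1) → ℕ}
    (hv : v ∈ antitoneCompositions n (e + 1)) : ∑ i, (v i : ℤ) = n := by
  rw [← Nat.cast_sum, (mem_antitoneCompositions.1 hv).1]

theorem measurable_latticeStep (hr : 0 < r) : Measurable (latticeStep W r n) :=
  Finset.measurable_sum _ fun _ hv => measurable_const.indicator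
    (measurableSet_latticePoint_eq hr (sum_intCast_of_mem_antitoneCompositions hv))

theorem integral_latticeStep (hr : 0 < r) :
    ∫ y, latticeStep W r n y = r⁻¹ ^ e * ∑ v ∈ antitoneCompositions n (e + 1), W v := by
  simp only [latticeStep]
  rw [integral_finsetSum, Finset.mul_sum]
  · refine Finset.sum_congr rfl fun v hv => ?_
    have hsum := sum_intCast_of_mem_antitoneCompositions hv
    rw [integral_indicator_const _ (measurableSet_latticePoint_eq hr hsum), measureReal_def,
      volume_latticePoint_eq hr hsum, ENNReal.toReal_ofReal (by positivity), smul_eq_mul]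
  · intro v hv
    have hsum := sum_intCast_of_mem_antitoneCompositions hv
    rw [integrable_indicator_iff (measurableSet_latticePoint_eq hr hsum)]
    exact integrableOn_const (by rw [volume_latticePoint_eq hr hsum]; exact ENNReal.ofReal_ne_top)

end LatticePoints

section RiemannSums

/-- The weights `W n` of vectors that fluctuate on the scale `r n` about the constant vector `n / d`
converge to `F` locally uniformly in the fluctuation, with a majorant integrable over it. -/
structure HasScalingLimit {d : ℕ} (W : ℕ → (Fin d → ℕ) → ℝ) (r : ℕ → ℝ) (F : (Fin d → ℝ) → ℝ) :
    Prop where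
  tendsto : ∀ (x : Fin d → ℝ) (v : ℕ → Fin d → ℕ), StrictAnti x →
    (∀ i, Tendsto (fun n : ℕ => ((v n i : ℝ) - n / d) / r n) atTop (𝓝 (x i))) →
    Tendsto (fun n => W n (v n)) atTop (𝓝 (F x))
  bound : ∃ A C : ℝ, 1 < A ∧ 0 ≤ C ∧ ∀ᶠ n : ℕ in atTop, ∀ v ∈ antitoneCompositions n d,
    |W n v| ≤ C * (∏ i, (1 + |((v i : ℝ) - n / d) / r n|)) ^ (-A)

variable {e : ℕ} {r : ℕ → ℝ} {W : ℕ → (Fin (e + 1) → ℕ) → ℝ} {F : (Fin (e + 1) → ℝ) → ℝ}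

theorem tendsto_latticePoint (hr : Tendsto r atTop atTop) (y : Fin e → ℝ) (i : Fin (e + 1)) :
    Tendsto (fun n => ((latticePoint (r n) n y i : ℝ) - n / (e + 1 : ℕ)) / r n) atTop
      (𝓝 (tracelessExtend (e + 1) y i)) := by
  refine tendsto_iff_norm_sub_tendsto_zero.2 (squeeze_zero' (.of_forall fun _ => norm_nonneg _) ?_
    (hr.const_div_atTop (e : ℝ)))
  filter_upwards [hr.eventually_gt_atTop 0] with n hn
  exact abs_latticePoint_sub_le hn y i

theorem eventually_latticePoint_lt (hr : Tendsto r atTop atTop) {y : Fin e → ℝ} {i j : Fin (e + 1)}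
    (hij : tracelessExtend (e + 1) y i < tracelessExtend (e + 1) y j) :
    ∀ᶠ n in atTop, latticePoint (r n) n y i < latticePoint (r n) n y j := by
  filter_upwards [(tendsto_latticePoint hr y i).eventually_lt (tendsto_latticePoint hr y j) hij,
    hr.eventually_gt_atTop 0] with n hlt hn
  rwa [div_lt_div_iff_of_pos_right hn, sub_lt_sub_iff_right, Int.cast_lt] at hlt

theorem eventually_latticePoint_pos (hr : Tendsto r atTop atTop)
    (hnr : Tendsto (fun n : ℕ => n / r n) atTop atTop) (y : Fin e → ℝ) (i : Fin (e + 1)) :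
    ∀ᶠ n in atTop, 0 < latticePoint (r n) n y i := by
  have hmean : Tendsto (fun n : ℕ => (n : ℝ) / (e + 1 : ℕ) / r n) atTop atTop :=
    (hnr.atTop_div_const (Nat.cast_pos.2 e.succ_pos)).congr fun n => div_right_comm _ _ _
  filter_upwards [((tendsto_latticePoint hr y i).add_atTop hmean).eventually_gt_atTop 0,
    hr.eventually_gt_atTop 0] with n hpos hn
  rwa [← add_div, sub_add_cancel, div_pos_iff_of_pos_right hn, Int.cast_pos] at hpos

theorem exists_tendsto_antitoneCompositions (hr : Tendsto r atTop atTop)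
    (hnr : Tendsto (fun n : ℕ => n / r n) atTop atTop) {y : Fin e → ℝ}
    (hy : StrictAnti (tracelessExtend (e + 1) y)) :
    ∃ v : ℕ → Fin (e + 1) → ℕ,
      (∀ᶠ n in atTop, v n ∈ antitoneCompositions n (e + 1) ∧
        latticePoint (r n) n y = fun i => (v n i : ℤ)) ∧
      ∀ i, Tendsto (fun n => ((v n i : ℝ) - n / (e + 1 : ℕ)) / r n) atTop
        (𝓝 (tracelessExtend (e + 1) y i)) := by
  let v (n : ℕ) (i : Fin (e + 1)) : ℕ := (latticePoint (r n) n y i).toNat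
  have hcast : ∀ᶠ n in atTop, latticePoint (r n) n y = fun i => (v n i : ℤ) := by
    filter_upwards [eventually_all.2 (eventually_latticePoint_pos hr hnr y)] with n hpos
    exact funext fun i => (Int.toNat_of_nonneg (hpos i).le).symm
  have hlt : ∀ᶠ n in atTop, ∀ i j, i < j → latticePoint (r n) n y j < latticePoint (r n) n y i := by
    simp only [eventually_all]
    exact fun i j hij => eventually_latticePoint_lt hr (hy hij)
  refine ⟨v, ?_, fun i => (tendsto_latticePoint hr y i).congr' ?_⟩
  · filter_upwards [hcast, hlt] with n hn hanti
    refine ⟨mem_antitoneCompositions.2 ⟨?_, ?_⟩, hn⟩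
    · rw [← Int.natCast_inj, Nat.cast_sum, ← sum_latticePoint (r := r n) y, hn]
    · exact StrictAnti.antitone fun i j hij => by simpa only [hn, Nat.cast_lt] using hanti i j hij
  · filter_upwards [hcast] with n hn
    rw [hn, Int.cast_natCast]

theorem eventually_latticeStep_eq_zero (hr : Tendsto r atTop atTop) {y : Fin e → ℝ}
    (hy : ¬Antitone (tracelessExtend (e + 1) y)) :
    ∀ᶠ n in atTop, latticeStep (W n) (r n) n y = 0 := by
  simp only [Antitone, not_forall, not_le] at hy
  obtain ⟨i, j, hij, hlt⟩ := hy
  filter_upwards [eventually_latticePoint_lt hr hlt] with n hn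
  refine latticeStep_eq_zero fun v hv hyv => hn.not_ge ?_
  rw [hyv]
  exact Nat.cast_le.2 ((mem_antitoneCompositions.1 hv).2 hij)

theorem integrable_prod_one_add_abs_rpow (e : ℕ) {A : ℝ} (hA : 1 < A) :
    Integrable fun y : Fin e → ℝ => (∏ i, (1 + |y i|)) ^ (-A) := by
  have hline : Integrable fun x : ℝ => (1 + |x|) ^ (-A) :=
    integrable_one_add_norm (by simpa only [Module.finrank_self, Nat.cast_one] using hA)
  refine (Integrable.fintype_prod fun _ : Fin e => hline).congr (.of_forall fun y => ?_)
  exact Real.finsetProd_rpow _ _ (fun i _ => by positivity) _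

theorem prod_one_add_abs_le {r : ℝ} (hr : 1 ≤ r) (n : ℕ) (y : Fin e → ℝ) :
    ∏ i, (1 + |y i|) ≤
      (1 + e) ^ e * ∏ i, (1 + |((latticePoint r n y i : ℝ) - n / (e + 1 : ℕ)) / r|) := by
  let ξ (i : Fin (e + 1)) : ℝ := ((latticePoint r n y i : ℝ) - n / (e + 1 : ℕ)) / r
  have hcoord (i : Fin e) : 1 + |y i| ≤ (1 + e) * (1 + |ξ i.castSucc|) := by
    have hround : |ξ i.castSucc - y i| ≤ e :=
      tracelessExtend_castSucc y i ▸ (abs_latticePoint_sub_le (zero_lt_one.trans_le hr) y _).trans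
        (div_le_self e.cast_nonneg hr)
    have htri : |y i| ≤ |ξ i.castSucc| + |ξ i.castSucc - y i| := by
      simpa only [sub_sub_cancel] using abs_sub (ξ i.castSucc) (ξ i.castSucc - y i)
    have hprod : 0 ≤ e * |ξ i.castSucc| := by positivity
    linarith
  calc ∏ i, (1 + |y i|) ≤ ∏ i : Fin e, ((1 + e) * (1 + |ξ i.castSucc|)) :=
        Finset.prod_le_prod (fun i _ => by positivity) fun i _ => hcoord i
    _ = (1 + e) ^ e * ∏ i : Fin e, (1 + |ξ i.castSucc|) := by
        rw [Finset.prod_mul_distrib, Fin.prod_const]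
    _ ≤ (1 + e) ^ e * ∏ i, (1 + |ξ i|) := by
        rw [Fin.prod_univ_castSucc]
        gcongr
        exact le_mul_of_one_le_right (by positivity) (le_add_of_nonneg_right (abs_nonneg _))

theorem abs_latticeStep_le {W : (Fin (e + 1) → ℕ) → ℝ} {r A C : ℝ} {n : ℕ} (hr : 1 ≤ r) (hA : 0 ≤ A)
    (hC : 0 ≤ C)
    (hW : ∀ v ∈ antitoneCompositions n (e + 1),
      |W v| ≤ C * (∏ i, (1 + |((v i : ℝ) - n / (e + 1 : ℕ)) / r|)) ^ (-A)) (y : Fin e → ℝ) :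
    |latticeStep W r n y| ≤ C * ((1 + e) ^ e) ^ A * (∏ i, (1 + |y i|)) ^ (-A) := by
  by_cases h : ∃ v ∈ antitoneCompositions n (e + 1), latticePoint r n y = fun i => (v i : ℤ)
  · obtain ⟨v, hv, hy⟩ := h
    have hprod := prod_one_add_abs_le hr n y
    simp only [hy, Int.cast_natCast] at hprod
    rw [latticeStep_eq hv hy]
    calc |W v| ≤ C * (∏ i, (1 + |((v i : ℝ) - n / (e + 1 : ℕ)) / r|)) ^ (-A) := hW v hv
      _ ≤ C * ((∏ i, (1 + |y i|)) / (1 + e) ^ e) ^ (-A) :=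
          mul_le_mul_of_nonneg_left (Real.rpow_le_rpow_of_nonpos (by positivity)
            ((div_le_iff₀' (by positivity)).2 hprod) (neg_nonpos.2 hA)) hC
      _ = C * ((1 + e) ^ e) ^ A * (∏ i, (1 + |y i|)) ^ (-A) := by
          rw [Real.div_rpow (by positivity) (by positivity), Real.rpow_neg (x := (1 + e : ℝ) ^ e)
            (by positivity), div_inv_eq_mul]
          ring
  · rw [latticeStep_eq_zero fun v hv hy => h ⟨v, hv, hy⟩, abs_zero]
    positivity

theorem HasScalingLimit.ae_tendsto_latticeStep (hW : HasScalingLimit W r F)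
    (hr : Tendsto r atTop atTop) (hnr : Tendsto (fun n : ℕ => n / r n) atTop atTop) :
    ∀ᵐ y : Fin e → ℝ, Tendsto (fun n => latticeStep (W n) (r n) n y) atTop
      (𝓝 ((chamberDomain e).indicator
        (fun y => F (tracelessExtend (e + 1) y)) y)) := by
  filter_upwards [ae_tracelessExtend_injective] with y hy
  by_cases hanti : Antitone (tracelessExtend (e + 1) y)
  · rw [Set.indicator_of_mem (mem_chamberDomain.2 hanti)]
    have hstrict := hanti.strictAnti_of_injective hy
    obtain ⟨v, hv, hlim⟩ := exists_tendsto_antitoneCompositions hr hnr hstrict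
    refine (hW.tendsto _ v hstrict hlim).congr' ?_
    filter_upwards [hv] with n hn
    exact (latticeStep_eq hn.1 hn.2).symm
  · rw [Set.indicator_of_notMem (mt mem_chamberDomain.1 hanti)]
    exact tendsto_const_nhds.congr' (EventuallyEq.symm (eventually_latticeStep_eq_zero hr hanti))

theorem HasScalingLimit.exists_integrable_bound (hW : HasScalingLimit W r F)
    (hr : Tendsto r atTop atTop) :
    ∃ g : (Fin e → ℝ) → ℝ, Integrable g ∧
      ∀ᶠ n in atTop, ∀ y, ‖latticeStep (W n) (r n) n y‖ ≤ g y := by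
  obtain ⟨A, C, hA, hC, hbound⟩ := hW.bound
  refine ⟨fun y => C * ((1 + e) ^ e) ^ A * (∏ i, (1 + |y i|)) ^ (-A),
    (integrable_prod_one_add_abs_rpow e hA).const_mul _, ?_⟩
  filter_upwards [hbound, hr.eventually_ge_atTop 1] with n hn hrn
  exact abs_latticeStep_le hrn (zero_le_one.trans hA.le) hC hn

theorem HasScalingLimit.integrableOn (hW : HasScalingLimit W r F) (hr : Tendsto r atTop atTop)
    (hnr : Tendsto (fun n : ℕ => n / r n) atTop atTop) :
    IntegrableOn (fun y => F (tracelessExtend (e + 1) y)) (chamberDomain e) := by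
  obtain ⟨g, hg, hbound⟩ := hW.exists_integrable_bound hr
  obtain ⟨N, hN⟩ := (hr.eventually_gt_atTop 0).exists_forall_of_atTop
  have hlim := hW.ae_tendsto_latticeStep hr hnr
  have hmeas (n : ℕ) : AEStronglyMeasurable (latticeStep (W (n + N)) (r (n + N)) (n + N)) :=
    (measurable_latticeStep (hN (n + N) (Nat.le_add_left N n))).aestronglyMeasurable
  rw [← integrable_indicator_iff (measurableSet_chamberDomain e)]
  refine hg.mono' (aestronglyMeasurable_of_tendsto_ae atTop hmeas ?_) ?_
  · filter_upwards [hlim] with y hy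
    exact hy.comp (tendsto_add_atTop_nat N)
  · filter_upwards [hlim] with y hy
    exact le_of_tendsto hy.norm (hbound.mono fun n hn => hn y)

theorem HasScalingLimit.tendsto_sum (hW : HasScalingLimit W r F) (hr : Tendsto r atTop atTop)
    (hnr : Tendsto (fun n : ℕ => n / r n) atTop atTop) :
    Tendsto (fun n => (r n)⁻¹ ^ e * ∑ v ∈ antitoneCompositions n (e + 1), W n v) atTop
      (𝓝 (∫ y in chamberDomain e, F (tracelessExtend (e + 1) y))) := by
  obtain ⟨g, hg, hbound⟩ := hW.exists_integrable_bound hr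
  rw [← integral_indicator (measurableSet_chamberDomain e)]
  refine (tendsto_integral_filter_of_dominated_convergence g ?_ ?_ hg
    (hW.ae_tendsto_latticeStep hr hnr)).congr' ?_
  · filter_upwards [hr.eventually_gt_atTop 0] with n hn
    exact (measurable_latticeStep hn).aestronglyMeasurable
  · exact hbound.mono fun n hn => .of_forall hn
  · filter_upwards [hr.eventually_gt_atTop 0] with n hn
    exact integral_latticeStep hn

end RiemannSums

section RegevIntegral

/-- The integrand of `Z'_d(β)`, as a function on all of `ℝ^d`. -/
noncomputable def regevIntegrand (d : ℕ) (β : ℝ) (x : Fin d → ℝ) : ℝ :=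
  Real.exp (-((d : ℝ) * β / 2) * ∑ i, x i ^ 2) * ∏ i, ∏ j ∈ Finset.Ioi i, (x i - x j) ^ β

theorem regevIntegral_eq_integral_regevIntegrand (e : ℕ) (β : ℝ) :
    regevIntegral (e + 1) β =
      ∫ y in chamberDomain e, regevIntegrand (e + 1) β (tracelessExtend (e + 1) y) := rfl

theorem regevIntegrand_nonneg {d : ℕ} {β : ℝ} {x : Fin d → ℝ} (hx : Antitone x) :
    0 ≤ regevIntegrand d β x :=
  mul_nonneg (Real.exp_pos _).le (Finset.prod_nonneg fun _ _ => Finset.prod_nonneg fun _ hj =>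
    Real.rpow_nonneg (sub_nonneg.2 (hx (Finset.mem_Ioi.1 hj).le)) _)

theorem regevIntegrand_pos {d : ℕ} {β : ℝ} {x : Fin d → ℝ} (hx : StrictAnti x) :
    0 < regevIntegrand d β x :=
  mul_pos (Real.exp_pos _) (Finset.prod_pos fun _ _ => Finset.prod_pos fun _ hj =>
    Real.rpow_pos_of_pos (sub_pos.2 (hx (Finset.mem_Ioi.1 hj))) _)

theorem sq_prod_exp_mul_prod_sub_rpow {d : ℕ} {θ : ℝ} (hθ : 0 ≤ θ) {x : Fin d → ℝ}
    (hx : Antitone x) :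
    (∏ i, (Real.exp (-((√(θ * d) * x i) ^ 2 / 2)) / √(2 * Real.pi) *
        ∏ j ∈ Finset.Ioi i, (x i - x j) ^ θ)) ^ 2 =
      (2 * Real.pi)⁻¹ ^ d * regevIntegrand d (2 * θ) x := by
  have hexp (i : Fin d) : Real.exp (-((√(θ * d) * x i) ^ 2 / 2)) ^ 2 =
      Real.exp (-(d * (2 * θ) / 2) * x i ^ 2) := by
    rw [← Real.exp_nat_mul, mul_pow, Real.sq_sqrt (by positivity)]
    push_cast
    ring_nf
  have hrpow (i j : Fin d) (hij : j ∈ Finset.Ioi i) :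
      ((x i - x j) ^ θ) ^ 2 = (x i - x j) ^ (2 * θ) := by
    rw [← Real.rpow_mul_natCast (sub_nonneg.2 (hx (Finset.mem_Ioi.1 hij).le)), Nat.cast_ofNat,
      mul_comm]
  have hrow (i : Fin d) : (Real.exp (-((√(θ * d) * x i) ^ 2 / 2)) / √(2 * Real.pi) *
      ∏ j ∈ Finset.Ioi i, (x i - x j) ^ θ) ^ 2 =
        (2 * Real.pi)⁻¹ * (Real.exp (-(d * (2 * θ) / 2) * x i ^ 2) *
          ∏ j ∈ Finset.Ioi i, (x i - x j) ^ (2 * θ)) := by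
    rw [mul_pow, div_pow, hexp, Real.sq_sqrt Real.two_pi_pos.le, ← Finset.prod_pow,
      Finset.prod_congr rfl (hrpow i), div_mul_eq_mul_div, inv_mul_eq_div]
  rw [← Finset.prod_pow, Finset.prod_congr rfl fun i _ => hrow i, Finset.prod_mul_distrib,
    Finset.prod_mul_distrib, Fin.prod_const, ← Real.exp_sum, ← Finset.mul_sum, regevIntegrand]

/-- The weight of a partition with row lengths `v` in the sum over partitions of `n`: the product
of the normalized inverses of its two hook products, at the mean row length `n / d` and on the
scale `√(θ n)` of the fluctuations, where `θ = 1 / α`. -/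
noncomputable def jackWeight (θ : ℝ) (d n : ℕ) (v : Fin d → ℕ) : ℝ :=
  hookWeight θ θ √(θ * n) (n / d) v * hookWeight θ 1 √(θ * n) (n / d) v

theorem sqrt_mul_eq_sqrt_mul_sqrt_div {d : ℕ} (hd : 0 < d) {θ : ℝ} (hθ : 0 ≤ θ) (t : ℝ) :
    √(θ * t) = √(θ * d) * √(t / d) := by
  rw [← Real.sqrt_mul (by positivity), mul_assoc, mul_div_cancel₀ t (by positivity)]

theorem exists_jackWeight_le {d : ℕ} (hd : 0 < d) {θ : ℝ} (hθ : 0 < θ) :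
    ∃ C, 0 ≤ C ∧ ∀ n : ℕ, 0 < n → ∀ v ∈ antitoneCompositions n d,
      |jackWeight θ d n v| ≤
        C * (∏ i, (1 + |((v i : ℝ) - n / d) / √(θ * n)|)) ^ (-2 : ℝ) := by
  have hd' : (0 : ℝ) < d := Nat.cast_pos.2 hd
  obtain ⟨C, hC, hlower⟩ := exists_hookWeight_le d hθ.le hθ zero_le_one
    (Real.sqrt_pos.2 (mul_pos hθ hd')) (one_div_pos.2 hd') hd'.le
  obtain ⟨D, hD, hupper⟩ := exists_hookWeight_le d hθ.le one_pos zero_le_one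
    (Real.sqrt_pos.2 (mul_pos hθ hd')) (one_div_pos.2 hd') hd'.le
  refine ⟨C * D, mul_nonneg hC hD, fun n hn v hv => ?_⟩
  have hm : (1 : ℝ) / d ≤ n / d := by
    gcongr
    exact_mod_cast hn
  have hrows (i : Fin d) : (v i : ℝ) ≤ d * (n / d) := by
    rw [mul_div_cancel₀ _ hd'.ne']
    exact_mod_cast le_of_mem_antitoneCompositions hv i
  have hP : 0 < ∏ i, (1 + |((v i : ℝ) - n / d) / √(θ * n)|) :=
    Finset.prod_pos fun i _ => by positivity
  have hlower' := hlower _ hm v hrows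
  have hupper' := hupper _ hm v hrows
  rw [← sqrt_mul_eq_sqrt_mul_sqrt_div hd hθ.le] at hlower' hupper'
  have hnonneg {s : ℝ} (hs : 0 < s) : 0 ≤ hookWeight θ s √(θ * n) (n / d) v :=
    hookWeight_nonneg hθ.le hs (Real.sqrt_nonneg _) (by positivity) v
  rw [jackWeight, abs_of_nonneg (mul_nonneg (hnonneg hθ) (hnonneg one_pos))]
  refine (mul_le_mul hlower' hupper' (hnonneg one_pos) (by positivity)).trans_eq ?_
  rw [mul_mul_mul_comm, ← Real.rpow_add hP]
  norm_num

theorem tendsto_jackWeight {d : ℕ} (hd : 0 < d) {θ : ℝ} (hθ : 0 < θ) {x : Fin d → ℝ}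
    (hx : StrictAnti x) {v : ℕ → Fin d → ℕ}
    (hv : ∀ i, Tendsto (fun n : ℕ => ((v n i : ℝ) - n / d) / √(θ * n)) atTop (𝓝 (x i))) :
    Tendsto (fun n => jackWeight θ d n (v n)) atTop
      (𝓝 ((2 * Real.pi)⁻¹ ^ d * regevIntegrand d (2 * θ) x)) := by
  have hd' : (0 : ℝ) < d := Nat.cast_pos.2 hd
  have hm : Tendsto (fun n : ℕ => (n : ℝ) / d) atTop atTop :=
    tendsto_natCast_atTop_atTop.atTop_div_const hd'
  have hc : 0 < √(θ * d) := Real.sqrt_pos.2 (mul_pos hθ hd')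
  have hv' (i : Fin d) :
      Tendsto (fun n : ℕ => ((v n i : ℝ) - n / d) / (√(θ * d) * √(n / d))) atTop (𝓝 (x i)) :=
    (hv i).congr fun n => by rw [sqrt_mul_eq_sqrt_mul_sqrt_div hd hθ.le n]
  rw [← sq_prod_exp_mul_prod_sub_rpow hθ.le hx.antitone, sq]
  refine ((tendsto_hookWeight hθ.le hθ hc hm hx hv').mul
    (tendsto_hookWeight hθ.le one_pos hc hm hx hv')).congr fun n => ?_
  rw [jackWeight, sqrt_mul_eq_sqrt_mul_sqrt_div hd hθ.le n]

theorem hasScalingLimit_jackWeight {d : ℕ} (hd : 0 < d) {θ : ℝ} (hθ : 0 < θ) :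
    HasScalingLimit (jackWeight θ d) (fun n => √(θ * n))
      fun x => (2 * Real.pi)⁻¹ ^ d * regevIntegrand d (2 * θ) x where
  tendsto _ _ hx hv := tendsto_jackWeight hd hθ hx hv
  bound := by
    obtain ⟨C, hC, hbound⟩ := exists_jackWeight_le hd hθ
    exact ⟨2, C, one_lt_two, hC, (eventually_gt_atTop 0).mono hbound⟩

theorem tendsto_sqrt_mul_natCast {θ : ℝ} (hθ : 0 < θ) :
    Tendsto (fun n : ℕ => √(θ * n)) atTop atTop :=
  Real.tendsto_sqrt_atTop.comp (tendsto_natCast_atTop_atTop.const_mul_atTop hθ)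

theorem tendsto_natCast_div_sqrt_mul {θ : ℝ} (hθ : 0 < θ) :
    Tendsto (fun n : ℕ => n / √(θ * n)) atTop atTop := by
  refine ((tendsto_sqrt_mul_natCast hθ).const_mul_atTop (inv_pos.2 hθ)).congr fun n => ?_
  rw [← mul_div_mul_left _ _ hθ.ne', ← div_div, div_right_comm, Real.div_sqrt, inv_mul_eq_div]

theorem regevIntegral_pos (e : ℕ) {β : ℝ} (hβ : 0 < β) : 0 < regevIntegral (e + 1) β := by
  have hθ : 0 < β / 2 := half_pos hβ
  have hscaled := (hasScalingLimit_jackWeight e.succ_pos hθ).integrableOn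
    (tendsto_sqrt_mul_natCast hθ) (tendsto_natCast_div_sqrt_mul hθ)
  rw [mul_div_cancel₀ β two_ne_zero] at hscaled
  have hintegrand : IntegrableOn (fun y => regevIntegrand (e + 1) β (tracelessExtend (e + 1) y))
      (chamberDomain e) :=
    (integrable_const_mul_iff (by simp [Real.pi_ne_zero]) _).1 hscaled
  rw [regevIntegral_eq_integral_regevIntegrand, setIntegral_pos_iff_support_of_nonneg_ae
    ((ae_restrict_mem (measurableSet_chamberDomain e)).mono fun y hy =>
      regevIntegrand_nonneg (mem_chamberDomain.1 hy)) hintegrand]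
  refine (isOpen_strictAnti_tracelessExtend.measure_pos volume
    (exists_strictAnti_tracelessExtend e)).trans_le (measure_mono fun y hy => ?_)
  exact ⟨(regevIntegrand_pos hy).ne', mem_chamberDomain.2 (StrictAnti.antitone hy)⟩

theorem isEquivalent_sum_jackWeight (e : ℕ) {θ : ℝ} (hθ : 0 < θ) :
    Asymptotics.IsEquivalent atTop
      (fun n : ℕ => ∑ v ∈ antitoneCompositions n (e + 1), jackWeight θ (e + 1) n v)
      fun n => (2 * Real.pi)⁻¹ ^ (e + 1) * √(θ * n) ^ e * regevIntegral (e + 1) (2 * θ) := by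
  have hlim := (hasScalingLimit_jackWeight e.succ_pos hθ).tendsto_sum (tendsto_sqrt_mul_natCast hθ)
    (tendsto_natCast_div_sqrt_mul hθ)
  have hconst : (2 * Real.pi)⁻¹ ^ (e + 1) * regevIntegral (e + 1) (2 * θ) ≠ 0 :=
    (mul_pos (by positivity) (regevIntegral_pos e (by positivity))).ne'
  rw [integral_const_mul, ← regevIntegral_eq_integral_regevIntegrand] at hlim
  have hequiv := ((Asymptotics.isEquivalent_const_iff_tendsto hconst).2 hlim).mul
    (Asymptotics.IsEquivalent.refl (u := fun n : ℕ => √(θ * n) ^ e))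
  refine (hequiv.congr_left ?_).congr_right (.of_forall fun n => mul_right_comm _ _ _)
  filter_upwards [eventually_gt_atTop 0] with n hn
  have hscale : √(θ * n) ^ e ≠ 0 := by positivity
  simp only [Pi.mul_apply, inv_pow]
  field_simp

end RegevIntegral

section Summation

/-- The factor that relates `1 / (c_λ c'_λ)` to `jackWeight` for partitions `λ` of `n` with at most
`d` parts. -/
noncomputable def jackFactor (α : ℝ) (d n : ℕ) : ℝ :=
  (α ^ (2 * n))⁻¹ * Real.Gamma (1 / α) ^ d * Real.exp (2 * n) *
    (n / d : ℝ) ^ (-(2 * n + 1 / α * d ^ 2)) * √(1 / α * n) ^ (2 * (1 / α * d.choose 2))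

theorem inv_jackHookLower_mul_inv_jackHookUpper {α : ℝ} (hα : 0 < α) {d n : ℕ} (hd : 0 < d)
    (hn : 0 < n) {μ : YoungDiagram} (hμ : μ ∈ partitionsOfLengthLE n d) :
    (jackHookLower α μ)⁻¹ * (jackHookUpper α μ)⁻¹ =
      jackFactor α d n * jackWeight (1 / α) d n fun i => μ.rowLen i := by
  obtain ⟨rfl, hlen⟩ := mem_partitionsOfLengthLE.1 hμ
  have hθ : 0 < 1 / α := one_div_pos.2 hα
  have hm : (0 : ℝ) < μ.card / d := by positivity
  have hr : 0 < √(1 / α * μ.card) := by positivity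
  rw [jackHookLower_eq hα.ne', jackHookUpper_eq hα.ne', mul_inv, mul_inv,
    inv_hookProduct_eq hlen hθ.le hθ hr hm, inv_hookProduct_eq hlen hθ.le one_pos hr hm, jackFactor,
    jackWeight]
  have hexp : Real.exp (2 * μ.card) =
      Real.exp (d * (μ.card / d)) * Real.exp (d * (μ.card / d)) := by
    rw [mul_div_cancel₀ _ (by positivity), ← Real.exp_add, two_mul]
  have hexponent : -(2 * (μ.card : ℝ) + 1 / α * d ^ 2) =
      -(μ.card + d * (1 / α - 1 / 2) + 1 / α * d.choose 2) +
        -(μ.card + d * (1 - 1 / 2) + 1 / α * d.choose 2) := by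
    rw [Nat.cast_choose_two]
    ring
  rw [hexp, hexponent, Real.rpow_add hm, two_mul (1 / α * (d.choose 2 : ℝ)), Real.rpow_add hr,
    Real.Gamma_one, one_pow, two_mul, pow_add]
  ring

theorem sum_factorial_div_jackHook {α : ℝ} (hα : 0 < α) {d n : ℕ} (hd : 0 < d) (hn : 0 < n) :
    ∑ μ ∈ partitionsOfLengthLE n d,
        ((n.factorial : ℝ) / jackHookLower α μ) * ((n.factorial : ℝ) / jackHookUpper α μ) =
      (n.factorial : ℝ) ^ 2 * jackFactor α d n *
        ∑ v ∈ antitoneCompositions n d, jackWeight (1 / α) d n v := by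
  rw [Finset.mul_sum]
  refine sum_partitionsOfLengthLE_eq fun μ hμ => ?_
  rw [mul_assoc, ← inv_jackHookLower_mul_inv_jackHookUpper hα hd hn hμ]
  ring

theorem isEquivalent_factorial_sq :
    Asymptotics.IsEquivalent atTop (fun n : ℕ => (n.factorial : ℝ) ^ 2)
      fun n => 2 * Real.pi * n * (n ^ (2 * n) / Real.exp (2 * n)) := by
  refine (Stirling.factorial_isEquivalent_stirling.pow 2).congr_right (.of_forall fun n => ?_)
  simp only [Pi.pow_apply, mul_pow]
  rw [Real.sq_sqrt (by positivity), ← pow_mul, mul_comm n 2, div_pow, ← Real.exp_nat_mul]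
  push_cast
  ring_nf

theorem sqrt_rpow_mul_sqrt_pow {α : ℝ} (hα : 0 < α) {d n : ℕ} (hd : 0 < d) (hn : 0 < n) :
    √(1 / α * n) ^ (2 * (1 / α * d.choose 2)) * √(1 / α * n) ^ (d - 1) =
      (n : ℝ) ^ (((d : ℝ) ^ 2 - d) / (2 * α) + ((d : ℝ) - 1) / 2) /
        α ^ (((d : ℝ) ^ 2 - d) / (2 * α) + ((d : ℝ) - 1) / 2) := by
  rw [← Real.div_rpow n.cast_nonneg hα.le, one_div_mul_eq_div, ← Real.rpow_natCast _ (d - 1),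
    ← Real.rpow_add (by positivity), Real.sqrt_eq_rpow, ← Real.rpow_mul (by positivity),
    Nat.cast_pred hd, Nat.cast_choose_two]
  congr 1
  field_simp

theorem stirling_mul_jackFactor_eq {α : ℝ} (hα : 0 < α) {d n : ℕ} (hd : 0 < d) (hn : 0 < n) :
    2 * Real.pi * n * (n ^ (2 * n) / Real.exp (2 * n)) * jackFactor α d n *
        ((2 * Real.pi)⁻¹ ^ d * √(1 / α * n) ^ (d - 1)) =
      (Real.Gamma (1 / α) ^ d * (d : ℝ) ^ (2 * (n : ℝ) + (d : ℝ) ^ 2 / α)) /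
        ((2 * Real.pi) ^ (d - 1) *
          α ^ (2 * (n : ℝ) + ((d : ℝ) ^ 2 - d) / (2 * α) + ((d : ℝ) - 1) / 2) *
          (n : ℝ) ^ (((d : ℝ) ^ 2 + d) / (2 * α) - ((d : ℝ) + 1) / 2)) := by
  have hn' : (0 : ℝ) < n := Nat.cast_pos.2 hn
  have hd' : (0 : ℝ) < d := Nat.cast_pos.2 hd
  have hroot := sqrt_rpow_mul_sqrt_pow hα hd hn
  set a : ℝ := ((d : ℝ) ^ 2 - d) / (2 * α) + ((d : ℝ) - 1) / 2
  set q : ℝ := ((d : ℝ) ^ 2 + d) / (2 * α) - ((d : ℝ) + 1) / 2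
  have hnat (x : ℝ) : x ^ (2 * (n : ℝ)) = x ^ (2 * n) := by
    rw [← Real.rpow_natCast, Nat.cast_mul, Nat.cast_ofNat]
  have hα_pow : α ^ (2 * (n : ℝ) + ((d : ℝ) ^ 2 - d) / (2 * α) + ((d : ℝ) - 1) / 2) =
      α ^ (2 * n) * α ^ a := by
    rw [add_assoc, Real.rpow_add hα, hnat]
  have hmean : (n / d : ℝ) ^ (-(2 * n + 1 / α * d ^ 2)) =
      d ^ (2 * n + d ^ 2 / α) / (n ^ (2 * n) * n ^ (d ^ 2 / α)) := by
    rw [Real.rpow_neg (by positivity), Real.div_rpow hn'.le hd'.le, inv_div, one_div_mul_eq_div,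
      Real.rpow_add hn', hnat]
  have hn_pow : (n : ℝ) ^ ((d : ℝ) ^ 2 / α) = n * n ^ a * n ^ q := by
    have hexponent : (d : ℝ) ^ 2 / α = 1 + a + q := by
      simp only [a, q]
      field_simp
      ring
    rw [hexponent, Real.rpow_add hn', Real.rpow_add hn', Real.rpow_one]
  calc _ = 2 * Real.pi * n * Real.Gamma (1 / α) ^ d * d ^ (2 * n + d ^ 2 / α : ℝ) /
        ((2 * Real.pi) ^ d * α ^ (2 * n) * n ^ ((d : ℝ) ^ 2 / α)) *
          (√(1 / α * n) ^ (2 * (1 / α * d.choose 2)) * √(1 / α * n) ^ (d - 1)) := by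
        rw [jackFactor, hmean, inv_pow]
        field_simp
    _ = _ := by
        rw [hroot, hα_pow, hn_pow, ← pow_sub_one_mul hd.ne' (2 * Real.pi)]
        field_simp

end Summation

theorem mainTheorem4 (d : ℕ) (hd : 1 ≤ d) (α : ℝ) (hα : 0 < α) :
    Asymptotics.IsEquivalent Filter.atTop
      (fun n : ℕ => ∑ μ ∈ partitionsOfLengthLE n d,
        ((n.factorial : ℝ) / jackHookLower α μ) * ((n.factorial : ℝ) / jackHookUpper α μ))
      (fun n : ℕ =>
        (Real.Gamma (1 / α) ^ d * (d : ℝ) ^ (2 * (n : ℝ) + (d : ℝ) ^ 2 / α)) /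
          ((2 * Real.pi) ^ (d - 1) *
            α ^ (2 * (n : ℝ) + ((d : ℝ) ^ 2 - d) / (2 * α) + ((d : ℝ) - 1) / 2) *
            (n : ℝ) ^ (((d : ℝ) ^ 2 + d) / (2 * α) - ((d : ℝ) + 1) / 2)) *
          regevIntegral d (2 / α)) := by
  obtain ⟨e, rfl⟩ := Nat.exists_eq_add_of_le' hd
  have hequiv := (isEquivalent_factorial_sq.mul
    (Asymptotics.IsEquivalent.refl (u := jackFactor α (e + 1)))).mul
      (isEquivalent_sum_jackWeight e (one_div_pos.2 hα))
  rw [mul_one_div] at hequiv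
  refine (hequiv.congr_left ?_).congr_right ?_ <;>
    filter_upwards [eventually_gt_atTop 0] with n hn
  · exact (sum_factorial_div_jackHook hα hd hn).symm
  · rw [← stirling_mul_jackFactor_eq hα hd hn]
    exact (mul_assoc _ _ _).symm
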